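/- **Theorem 3.3.** All posets are finite. A poset is connected if its Hasse diagram, viewed as an undirected graph, is connected, and acyclic if its Hasse diagram has no cycle. A *diamond* is a poset $\{a,b,c,d\}$ with $a<b<d$, $a<c<d$ and $b,c$ incomparable; a *bowtie* is $\{e,f,g,h\}$ with $e,f<g,h$ and both pairs $e,f$ and $g,h$ incomparable; a *Y-poset* is $\{e,f,g,h\}$ with $e<f<g,h$ and $g,h$ incomparable. A connected poset is of *W-class* if it is acyclic and no induced subposet of it is a bowtie, a Y-poset or the dual of a Y-poset. A finite connected poset $\mathcal S$ is a *W-glued diamond* with diamond $\mathcal A=\{a,b,c,d\}$ (labelled as above) if 1. $\mathcal A$ is the unique induced subposet of $\mathcal S$ that is a diamond; 2. $\mathcal S$ has no induced subposet consisting of a diamond together with one element below its minimum, or with one element above its maximum, and no induced subposet on six elements whose Hasse diagram consists of a diamond $\{a',b',c',d'\}$ (labelled as above) and two further arcs joining $c'$ to an element $x<c'$ and to an element $y>c'$; 3. when the arcs $(a,b)$, $(a,c)$, $(b,d)$, $(c,d)$ are removed from the Hasse diagram of $\mathcal S$, the elements $a,b,c,d$ lie in four different connected components, and each of the four components, as an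 induced subposet of $\mathcal S$, is of W-class. A *system of measures* on $\mathcal S$ is a family $P=(P_\alpha:\alpha\in\mathcal A)$ of finite nonnegative measures on the finite set $\mathcal S$, with $\mathcal A$ ordered as a subposet of $\mathcal S$. It is *stochastically monotone* if, whenever $\alpha\le\beta$ in $\mathcal A$, $P_\alpha(\mathcal S)=P_\beta(\mathcal S)$ and $P_\alpha(U)\le P_\beta(U)$ for every up-set $U$ of $\mathcal S$. It is *realizably monotone* if there are a number $p$ and measurable maps $X_\alpha:[0,p)\to\mathcal S$, $\alpha\in\mathcal A$, such that $\lambda(\{\omega\in[0,p):X_\alpha(\omega)\in B\})=P_\alpha(B)$ for all $\alpha\in\mathcal A$ and $B\subseteq\mathcal S$, where $\lambda$ is Lebesgue measure, and $X_\alpha(\omega)\le X_\beta(\omega)$ for all $\omega\in[0,p)$ whenever $\alpha\le\beta$ in $\mathcal A$. It is *realizably weakly monotone* if for some $\theta\ge 0$ the system $P+\theta I=(P_\alpha+\theta I_\alpha:\alpha\in\mathcal A)$ is realizably monotone, where $I_\alpha$ is the unit mass at $\alpha$. Let $\mathcal S$ be a W-glued diamond with diamond $\mathcal A$. Then every stochastically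 monotone system $P=(P_\alpha:\alpha\in\mathcal A)$ of measures on $\mathcal S$ is realizably weakly monotone. -/

import Mathlib

open MeasureTheory

/-! Finite posets and their Hasse diagrams (`SimpleGraph.hasse`, an undirected graph). -/

/-- The four distinct elements `a`, `b`, `c`, `d` form an induced subposet that is a diamond:
`a < b < d`, `a < c < d`, with `b` and `c` incomparable. -/
def IsDiamond {S : Type*} [PartialOrder S] (a b c d : S) : Prop :=
  a < b ∧ a < c ∧ b < d ∧ c < d ∧ ¬ b ≤ c ∧ ¬ c ≤ b

/-- `e`, `f`, `g`, `h` form an induced bowtie: `e, f < g, h`, with `e, f` incomparable and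
`g, h` incomparable. -/
def IsBowtie {S : Type*} [PartialOrder S] (e f g h : S) : Prop :=
  e < g ∧ e < h ∧ f < g ∧ f < h ∧ ¬ e ≤ f ∧ ¬ f ≤ e ∧ ¬ g ≤ h ∧ ¬ h ≤ g

/-- `e`, `f`, `g`, `h` form an induced Y-poset: `e < f < g, h`, with `g, h` incomparable. -/
def IsYPoset {S : Type*} [PartialOrder S] (e f g h : S) : Prop :=
  e < f ∧ f < g ∧ f < h ∧ ¬ g ≤ h ∧ ¬ h ≤ g

/-- `e`, `f`, `g`, `h` form an induced dual Y-poset: `g, h < f < e`, with `g, h` incomparable. -/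
def IsDualYPoset {S : Type*} [PartialOrder S] (e f g h : S) : Prop :=
  f < e ∧ g < f ∧ h < f ∧ ¬ g ≤ h ∧ ¬ h ≤ g

/-- W-class (for a connected poset): the Hasse diagram has no cycle, and no induced subposet is
a bowtie, a Y-poset or a dual Y-poset. -/
structure IsWClass (S : Type*) [PartialOrder S] : Prop where
  acyclic : (SimpleGraph.hasse S).IsAcyclic
  noBowtie : ∀ e f g h : S, ¬ IsBowtie e f g h
  noY : ∀ e f g h : S, ¬ IsYPoset e f g h
  noDualY : ∀ e f g h : S, ¬ IsDualYPoset e f g h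

/-- The Hasse diagram with the four arcs `(a,b)`, `(a,c)`, `(b,d)`, `(c,d)` removed. -/
def hasseMinusDiamond {S : Type*} [PartialOrder S] (a b c d : S) : SimpleGraph S :=
  (SimpleGraph.hasse S).deleteEdges {s(a, b), s(a, c), s(b, d), s(c, d)}

/-- The set of vertices of the connected component of `α` after the four arcs are removed. -/
def diamondBranch {S : Type*} [PartialOrder S] (a b c d α : S) : Set S :=
  {x | (hasseMinusDiamond a b c d).Reachable α x}

/-- `S` is a W-glued diamond, whose diamond has the elements `a`, `b`, `c`, `d`. -/
structure IsWGluedDiamond {S : Type*} [PartialOrder S] (a b c d : S) : Prop where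
  /-- The Hasse diagram of `S` is connected. -/
  connected : (SimpleGraph.hasse S).Connected
  /-- `a`, `b`, `c`, `d` form an induced diamond ... -/
  diamond : IsDiamond a b c d
  /-- ... and it is the only one. -/
  unique : ∀ a' b' c' d' : S, IsDiamond a' b' c' d' →
    ({a', b', c', d'} : Set S) = {a, b, c, d}
  /-- No induced diamond with an element below its minimum. -/
  noBelow : ∀ a' b' c' d' x : S, IsDiamond a' b' c' d' → ¬ x < a'
  /-- Dually, no induced diamond with an element above its maximum. -/
  noAbove : ∀ a' b' c' d' x : S, IsDiamond a' b' c' d' → ¬ d' < x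
  /-- No induced six-element subposet whose Hasse diagram is a diamond `a', b', c', d'` with an
  additional `x` covered by `c'` and an additional `y` covering `c'`. -/
  noBelowAndAbove : ∀ a' b' c' d' x y : S, IsDiamond a' b' c' d' → x < c' → c' < y →
    ¬ x ≤ a' → ¬ a' ≤ x → ¬ x ≤ b' → ¬ b' ≤ x →
    ¬ y ≤ b' → ¬ b' ≤ y → ¬ y ≤ d' → ¬ d' ≤ y → False
  /-- Removing the four arcs of the diamond puts `a`, `b`, `c`, `d` in four different connected
  components ... -/
  separated : ∀ α ∈ ({a, b, c, d} : Set S), ∀ β ∈ ({a, b, c, d} : Set S),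
    (hasseMinusDiamond a b c d).Reachable α β → α = β
  /-- ... each of which, as an induced subposet of `S`, is in W-class. -/
  wClass : ∀ α ∈ ({a, b, c, d} : Set S), IsWClass (diamondBranch a b c d α)

/-! Systems of (finite) measures. -/

/-- A system of measures on `S` indexed by a poset is stochastically monotone if for `α ≤ β` the
measures have a common mass and `P α U ≤ P β U` for every up-set `U`. -/
def IsStochasticallyMonotone {ι S : Type*} [PartialOrder ι] [PartialOrder S] [MeasurableSpace S]
    (P : ι → Measure S) : Prop :=
  ∀ α β : ι, α ≤ β →
    P α Set.univ = P β Set.univ ∧ ∀ U : Set S, IsUpperSet U → P α U ≤ P β U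

/-- A system of measures is realizably monotone if there are maps `X α` from an interval `[0, p)`
with Lebesgue measure to `S` such that `X α` has distribution `P α` and `X α ω ≤ X β ω` for all
`ω` in `[0, p)` whenever `α ≤ β`. The values of `X α` outside `[0, p)` are immaterial. -/
def IsRealizablyMonotone {ι S : Type*} [PartialOrder ι] [PartialOrder S] [MeasurableSpace S]
    (P : ι → Measure S) : Prop :=
  ∃ (p : ℝ) (X : ι → ℝ → S),
    (∀ α, Measurable (X α)) ∧
    (∀ α, (volume.restrict (Set.Ico 0 p)).map (X α) = P α) ∧
    ∀ α β : ι, α ≤ β → ∀ ω ∈ Set.Ico 0 p, X α ω ≤ X β ω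

/-- A system `P` of measures on `S`, indexed by an induced subposet `A` of `S`, is realizably
weakly monotone if `P + θ I` is realizably monotone for some `θ ≥ 0`, where `I` is the system of
unit masses. -/
def IsRealizablyWeaklyMonotone {S : Type*} [PartialOrder S] [MeasurableSpace S] {A : Set S}
    (P : A → Measure S) : Prop :=
  ∃ θ : NNReal, IsRealizablyMonotone fun α : A => P α + θ • Measure.dirac (α : S)

/-!
A system is realizably monotone as soon as it lies in the cone `monoCone` generated by the systems
of point masses of monotone maps `f : 𝒜 → 𝒮`. As multiples of the identity may be added to the
system `P`, only its masses off the diagonal matter: it suffices to find an element of the cone that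
agrees with `P α` on `𝒮 ∖ {α}` for each `α` (`IsWGluedDiamond.exists_mem_monoCone`).

Without its four arcs the diamond leaves a forest with four components, rooted at `a, b, c, d`. An
arc `uv` of the forest separates from the diamond a set `side G u v` of elements, which is an upper
set if `u < v` and a lower set if `v < u`; stochastic monotonicity says that the masses of these
sets are monotone in the index. In a W-class poset branching occurs only at minimal and maximal
elements, so that the forest is made of chains. Along a chain, mass is transported by a queue: as
the index grows from `a` to `d`, particles enter the chain at its lower end and leave it at its
upper end, first in, first out. This has the right masses at every index and is monotone. Such a
transport through an arc is an `UpFlow` or a `DownFlow`; it is built by induction from the leaves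
(`IsOrderedForest.flow_side`), with `UpFlow.chain_step` along a chain and `DownFlow.of_upFlows`, or
its dual, at a branching point.

At the roots the flows are completed to monotone maps. At `a` all branches go up, at `d` all go
down, and particles outside the branches wait at the root (`bot_branch_mem`, `top_branch_mem`). At
`c` the branches all go up or all go down. The positions at `c` come for free at the index `c`, and
those at `a` and `d` at the indices `a` and `d`; but at the index `b` particles have to be at `a`,
`c` or `d`, where `P b` has limited mass. That this mass suffices, after the components of `a` and
`d` have taken their share, is exactly what stochastic monotonicity gives for the lower set formed
by the components of `a` and `c` and the upper set formed by those of `c` and `d`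
(`IsWGluedDiamond.exists_completion`). The root `b` is treated in the same way. The masses of `P b`
and `P c` on the diamond which remain unused are realized by maps that move only `b`, or only `c`,
within the diamond. -/

noncomputable section

open Set Finset NNReal
open scoped Classical

/-! ### The cone of realizably monotone systems -/

/-- The system of unit masses `δ_{f α}` at the values of a map `f`. -/
def pointMass {A S : Type*} (f : A → S) : A → S → ℝ := fun α z => if f α = z then 1 else 0

/-- The systems of finite measures (given by their weights `q α z`) that are nonnegative
combinations of the systems `pointMass f` with `f` monotone. By
`isRealizablyMonotone_of_mem_monoCone` these are realizably monotone. -/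
def monoCone (A S : Type*) [Preorder A] [Preorder S] : Submodule ℝ≥0 (A → S → ℝ) :=
  Submodule.span ℝ≥0 {q | ∃ f : A → S, Monotone f ∧ q = pointMass f}

/-- The time (Lebesgue measure) that the path `Y` spends in `z` during `I`. -/
def occ {S : Type*} (I : Set ℝ) (Y : ℝ → S) (z : S) : ℝ := volume.real (I ∩ {t | Y t = z})

lemma occ_congr {S : Type*} {I : Set ℝ} {Y Y' : ℝ → S} (h : ∀ t ∈ I, Y t = Y' t) (z : S) :
    occ I Y z = occ I Y' z := by
  unfold occ
  congr 1
  ext t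
  simp only [Set.mem_inter_iff, Set.mem_ofPred_eq]
  constructor
  · rintro ⟨ht, h'⟩; exact ⟨ht, by rw [← h t ht, h']⟩
  · rintro ⟨ht, h'⟩; exact ⟨ht, by rw [h t ht, h']⟩

lemma occ_const {S : Type*} (x y : ℝ) (v z : S) :
    occ (Ico x y) (fun _ => v) z = max (y - x) 0 * (if v = z then 1 else 0) := by
  unfold occ
  by_cases h : v = z
  · simp [h, Real.volume_real_Ico]
  · simp [h]

lemma occ_Ico_add {S : Type*} {Y : ℝ → S} {z : S} (hY : MeasurableSet {t | Y t = z}) {x y w : ℝ}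
    (hxy : x ≤ y) (hyw : y ≤ w) :
    occ (Ico x y) Y z + occ (Ico y w) Y z = occ (Ico x w) Y z := by
  unfold occ
  have hfin : ∀ x y : ℝ, volume (Ico x y ∩ {t | Y t = z}) ≠ ⊤ := fun x y =>
    ((measure_mono Set.inter_subset_left).trans_lt measure_Ico_lt_top).ne
  rw [← Set.Ico_union_Ico_eq_Ico hxy hyw, Set.union_inter_distrib_right,
    measureReal_union _ (measurableSet_Ico.inter hY) (hfin _ _) (hfin _ _)]
  · apply Set.disjoint_of_subset Set.inter_subset_left Set.inter_subset_left
    rw [Set.disjoint_left]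
    intro t ht ht'
    exact absurd ht.2 (not_lt.2 ht'.1)

lemma occ_eq_zero_of_le {S : Type*} {Y : ℝ → S} {z : S} {x y : ℝ} (h : y ≤ x) :
    occ (Ico x y) Y z = 0 := by
  simp [occ, Set.Ico_eq_empty (not_lt.2 h)]

section Cone

variable {A S : Type*} [PartialOrder A] [PartialOrder S]

lemma pointMass_mem {f : A → S} (hf : Monotone f) : pointMass f ∈ monoCone A S :=
  Submodule.subset_span ⟨f, hf, rfl⟩

lemma smul_mem_monoCone {q : A → S → ℝ} (hq : q ∈ monoCone A S) {r : ℝ} (hr : 0 ≤ r) :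
    (fun α z => r * q α z) ∈ monoCone A S :=
  (monoCone A S).smul_mem ⟨r, hr⟩ hq

lemma add_mem_monoCone {q q' : A → S → ℝ} (hq : q ∈ monoCone A S) (hq' : q' ∈ monoCone A S) :
    (fun α z => q α z + q' α z) ∈ monoCone A S :=
  (monoCone A S).add_mem hq hq'

lemma sum_mem_monoCone {ι : Type*} (I : Finset ι) {q : ι → A → S → ℝ}
    (hq : ∀ i ∈ I, q i ∈ monoCone A S) :
    (fun α z => ∑ i ∈ I, q i α z) ∈ monoCone A S := by
  have h := (monoCone A S).sum_mem hq
  convert h using 1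
  ext α z
  simp [Finset.sum_apply]

/-- Reversing the orders of both the index set and the state space changes nothing, since the
monotone maps remain the same. -/
lemma monoCone_dual {q : A → S → ℝ} :
    (q ∈ monoCone A S) ↔ (q : Aᵒᵈ → Sᵒᵈ → ℝ) ∈ monoCone Aᵒᵈ Sᵒᵈ := by
  have : {q : A → S → ℝ | ∃ f : A → S, Monotone f ∧ q = pointMass f} =
      {q : Aᵒᵈ → Sᵒᵈ → ℝ | ∃ f : Aᵒᵈ → Sᵒᵈ, Monotone f ∧ q = pointMass f} := by
    ext q
    constructor
    · rintro ⟨f, hf, rfl⟩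
      exact ⟨f, fun x y h => hf h, rfl⟩
    · rintro ⟨f, hf, rfl⟩
      exact ⟨f, fun x y h => hf (a := y) (b := x) h, rfl⟩
  unfold monoCone
  rw [this]
  rfl

lemma mass_eq_of_mem_monoCone [Fintype S] {q : A → S → ℝ} (hq : q ∈ monoCone A S) (α β : A) :
    ∑ z, q α z = ∑ z, q β z := by
  induction hq using Submodule.span_induction with
  | mem x h =>
    obtain ⟨f, -, rfl⟩ := h
    simp [pointMass]
  | zero => simp
  | add x y _ _ hx hy => simp only [Pi.add_apply, Finset.sum_add_distrib, hx, hy]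
  | smul r x _ hx => simp only [Pi.smul_apply, ← Finset.smul_sum, hx]

/-- A family of random variables on a set of finite Lebesgue measure which is pointwise monotone in
the index has its system of laws in the cone. -/
lemma occ_mem_monoCone [Finite A] [Finite S] {I : Set ℝ} (hI : MeasurableSet I)
    (hI' : volume I ≠ ⊤) {Y : A → ℝ → S} (hY : ∀ α z, MeasurableSet {t | Y α t = z})
    (hmono : ∀ t ∈ I, Monotone fun α => Y α t) :
    (fun α z => occ I (Y α) z) ∈ monoCone A S := by
  have := Fintype.ofFinite A
  have := Fintype.ofFinite S
  let E : (A → S) → Set ℝ := fun f => I ∩ {t | ∀ α, Y α t = f α}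
  have hE : ∀ f, MeasurableSet (E f) := fun f => hI.inter (by
    rw [Set.ofPred_forall]
    exact MeasurableSet.iInter fun α => hY α _)
  have hfin : ∀ f, volume (E f) ≠ ⊤ := fun f =>
    ((measure_mono Set.inter_subset_left).trans_lt (lt_top_iff_ne_top.2 hI')).ne
  have key : (fun α z => occ I (Y α) z) =
      fun α z => ∑ f : A → S, volume.real (E f) * pointMass f α z := by
    ext α z
    have h1 : I ∩ {t | Y α t = z} = ⋃ f ∈ Finset.univ.filter (fun f : A → S => f α = z), E f := by
      ext t
      simp only [Set.mem_inter_iff, Set.mem_ofPred_eq, Finset.mem_filter, Finset.mem_univ, true_and,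
        Set.mem_iUnion, E, exists_prop]
      constructor
      · rintro ⟨ht, h⟩
        exact ⟨fun α => Y α t, h, ht, fun _ => rfl⟩
      · rintro ⟨f, h, ht, h'⟩
        exact ⟨ht, by rw [h', h]⟩
    unfold occ
    rw [h1, measureReal_biUnion_finset _ (fun f _ => hE f) (fun f _ => hfin f), Finset.sum_filter]
    · simp [pointMass]
    · intro f _ g _ hfg
      refine Set.disjoint_left.2 fun t ht ht' => hfg ?_
      ext α
      rw [← ht.2 α, ht'.2 α]
  rw [key]
  refine sum_mem_monoCone _ fun f _ => ?_
  by_cases hf : Monotone f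
  · exact smul_mem_monoCone (pointMass_mem hf) measureReal_nonneg
  · have : E f = ∅ := by
      refine Set.eq_empty_of_forall_notMem fun t ht => hf ?_
      have := hmono t ht.1
      have hf' : (fun α => Y α t) = f := funext ht.2
      rwa [hf'] at this
    simp only [this, measureReal_empty, zero_mul]
    exact (monoCone A S).zero_mem

end Cone

/-! ### Flows through the branches -/

section Flow

/-- The data behind `UpFlow o v q`, where `o` is the least index. The system `q` splits into a
closed part `C` from the cone, in which every index has the same mass, and an open part: the
particle `t ≥ ∑ z, q o z` is present at the indices `α` with `t < ∑ z, q α z`, it then sits at `X α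
t ≥ v`, and it moves upwards as long as it is present. A particle that is absent at `α` is
understood to be somewhere below `v`, outside the part of the poset that carries `q`.

Measurability of the paths is stated through the preimages of points, so that no measurable
structure on `S` is needed and the notion dualizes. -/
structure IsUpFlow {A S : Type*} [PartialOrder A] [PartialOrder S] [Fintype S]
    (o : A) (v : S) (q C : A → S → ℝ) (X : A → ℝ → S) : Prop where
  closed : C ∈ monoCone A S
  meas : ∀ α z, MeasurableSet {t | X α t = z}
  le : ∀ α t, v ≤ X α t
  mass_mono : ∀ α β, α ≤ β → ∑ z, q α z ≤ ∑ z, q β z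
  mono : ∀ α β, α ≤ β → ∀ t, t < ∑ z, q α z → X α t ≤ X β t
  eq : ∀ α z, q α z = C α z + occ (Ico (∑ z, q o z) (∑ z, q α z)) (X α) z

/-- The system `q`, of mass increasing in the index, can be realized by particles that enter through
`v` from below, and then move upwards; see `IsUpFlow`. The index `o` is meant to be the least one.
-/
def UpFlow {A S : Type*} [PartialOrder A] [PartialOrder S] [Fintype S]
    (o : A) (v : S) (q : A → S → ℝ) : Prop := ∃ C X, IsUpFlow o v q C X

/-- The order dual of `UpFlow`: the mass of `q` decreases in the index; as the index grows,
particles move upwards to `v` and leave through it. The index `e` is meant to be the greatest one.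
-/
def DownFlow {A S : Type*} [PartialOrder A] [PartialOrder S] [Fintype S]
    (e : A) (v : S) (q : A → S → ℝ) : Prop :=
  UpFlow (A := Aᵒᵈ) (S := Sᵒᵈ) (OrderDual.toDual e) (OrderDual.toDual v) q

variable {A S : Type*} [PartialOrder A] [PartialOrder S] [Fintype S] {o e : A}
  {v w : S} {q C : A → S → ℝ} {X : A → ℝ → S}

/-- Absent particles may be placed at `g α`, for any monotone `g` with values below the entrance
`w`: the particles `t ∈ [s₁, s₂)` then move monotonically at all indices. -/
lemma IsUpFlow.completion_mem [Finite A] (h : IsUpFlow o w q C X) {g : A → S} (hg : Monotone g)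
    (hgw : ∀ α, g α ≤ w) (s₁ s₂ : ℝ) :
    (fun α z => occ (Ico s₁ (min s₂ (∑ z, q α z))) (X α) z +
      max (s₂ - max s₁ (∑ z, q α z)) 0 * pointMass g α z) ∈ monoCone A S := by
  let Y : A → ℝ → S := fun α t => if t < ∑ z, q α z then X α t else g α
  have hY : ∀ α z, MeasurableSet {t | Y α t = z} := by
    intro α z
    have : {t | Y α t = z} = (Iio (∑ z, q α z) ∩ {t | X α t = z}) ∪
        (Ici (∑ z, q α z) ∩ {_t | g α = z}) := by
      ext t
      by_cases ht : t < ∑ z, q α z <;> simp [Y, ht, not_le.2, not_lt.1]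
    rw [this]
    exact (measurableSet_Iio.inter (h.meas α z)).union
      (measurableSet_Ici.inter (MeasurableSet.const _))
  have hm : ∀ t ∈ Ico s₁ s₂, Monotone fun α => Y α t := by
    intro t _ α β hαβ
    simp only [Y]
    have := h.mass_mono α β hαβ
    split_ifs with h1 h2 h2
    · exact h.mono α β hαβ t h1
    · exact absurd (h1.trans_le this) h2
    · exact (hgw α).trans (h.le β t)
    · exact hg hαβ
  convert occ_mem_monoCone measurableSet_Ico (by simp) hY hm using 1
  ext α z
  have e1 : occ (Ico s₁ (min s₂ (∑ z, q α z))) (X α) z =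
      occ (Ico s₁ (min s₂ (∑ z, q α z))) (Y α) z := by
    apply occ_congr
    intro t ht
    have : t < ∑ z, q α z := ht.2.trans_le (min_le_right _ _)
    simp [Y, this]
  have e2 : max (s₂ - max s₁ (∑ z, q α z)) 0 * pointMass g α z =
      occ (Ico (max s₁ (∑ z, q α z)) s₂) (Y α) z := by
    rw [pointMass, ← occ_const]
    apply occ_congr
    intro t ht
    have : ¬ t < ∑ z, q α z := not_lt.2 ((le_max_right _ _).trans ht.1)
    simp [Y, this]
  rw [e1, e2]
  rcases le_total (∑ z, q α z) s₁ with h1 | h1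
  · rw [max_eq_left h1, occ_eq_zero_of_le ((min_le_right _ _).trans h1), zero_add]
  · rw [max_eq_right h1]
    rcases le_total (∑ z, q α z) s₂ with h2 | h2
    · rw [min_eq_right h2, occ_Ico_add (hY α z) h1 h2]
    · rw [min_eq_left h2, occ_eq_zero_of_le h2, add_zero]

lemma UpFlow.mass_mono (h : UpFlow o w q) {α β : A} (hαβ : α ≤ β) :
    ∑ z, q α z ≤ ∑ z, q β z := by
  obtain ⟨C, X, h⟩ := h
  exact h.mass_mono α β hαβ

/-- The particles of a flow may be completed by a random choice among several monotone maps `g j`,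
with probabilities `k' j` for the particles before time `s` and `k j` for those after `s`. The last
factor in each summand is the measure of the set of particles concerned that are absent at `α`. -/
lemma UpFlow.mixture_mem [Finite A] (h : UpFlow o w q) (ho : ∀ α, o ≤ α) (he : ∀ α, α ≤ e)
    {ι : Type*} (J : Finset ι) {g : ι → A → S} (hg : ∀ j ∈ J, Monotone (g j))
    (hgw : ∀ j ∈ J, ∀ α, g j α ≤ w) {k k' : ι → ℝ} (hk : ∀ j ∈ J, 0 ≤ k j)
    (hk' : ∀ j ∈ J, 0 ≤ k' j)
    (hk1 : ∑ j ∈ J, k j = 1) (hk1' : ∑ j ∈ J, k' j = 1) {s : ℝ} (hs : ∑ z, q o z ≤ s) :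
    (fun α z => q α z + ∑ j ∈ J, (k' j * max (s - ∑ z, q α z) 0 +
      k j * max (∑ z, q e z - max s (∑ z, q α z)) 0) * pointMass (g j) α z) ∈ monoCone A S := by
  obtain ⟨C, X, h⟩ := h
  have h1 := sum_mem_monoCone J fun j hj =>
    smul_mem_monoCone (h.completion_mem (hg j hj) (hgw j hj) (∑ z, q o z) s) (hk' j hj)
  have h2 := sum_mem_monoCone J fun j hj =>
    smul_mem_monoCone (h.completion_mem (hg j hj) (hgw j hj) s (∑ z, q e z)) (hk j hj)
  convert add_mem_monoCone h.closed (add_mem_monoCone h1 h2) using 1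
  ext α z
  have hoα := h.mass_mono _ _ (ho α)
  have heα := h.mass_mono _ _ (he α)
  rw [max_eq_right hoα, min_eq_right heα]
  simp only [mul_add, Finset.sum_add_distrib, ← Finset.sum_mul, hk1, hk1', one_mul, add_mul,
    ← mul_assoc]
  have : occ (Ico (∑ z, q o z) (∑ z, q α z)) (X α) z =
      occ (Ico (∑ z, q o z) (min s (∑ z, q α z))) (X α) z +
      occ (Ico s (∑ z, q α z)) (X α) z := by
    rcases le_total (∑ z, q α z) s with h3 | h3
    · rw [min_eq_right h3, occ_eq_zero_of_le h3, add_zero]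
    · rw [min_eq_left h3, occ_Ico_add (h.meas α z) hs h3]
  rw [h.eq α z, this]
  ring

/-- A flow is closed up by keeping all absent particles at one point `v` below the entrance. -/
lemma UpFlow.closing_mem [Finite A] (h : UpFlow o w q) (ho : ∀ α, o ≤ α) (he : ∀ α, α ≤ e)
    (hv : v ≤ w) :
    (fun α z => q α z + (∑ z, q e z - ∑ z, q α z) * (if v = z then 1 else 0)) ∈
      monoCone A S := by
  have := h.mixture_mem (J := {()}) (g := fun _ _ => v) (k := fun _ => 1) (k' := fun _ => 1) ho he
    (fun _ _ _ _ _ => le_rfl) (fun _ _ _ => hv) (by simp) (by simp) (by simp) (by simp)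
    (le_refl _)
  convert this using 1
  ext α z
  have h1 := h.mass_mono (ho α)
  have h2 := h.mass_mono (he α)
  simp [pointMass, h1, h2]

/-- Extension of a flow by one element `v` below its entrance `w`. The particles present in the
larger flow but not yet in the smaller one wait at `v`; particles pass from `v` to `w` in the same
order in which they enter `v`, and this first-in-first-out rule makes the masses at `v` come out
right. -/
lemma UpFlow.chain_step [Finite A] (h : UpFlow o w q) (ho : ∀ α, o ≤ α) (hv : v ≤ w) {r : A → ℝ}
    (hr : ∀ α, 0 ≤ r α)
    (hmono : ∀ α β, α ≤ β → ∑ z, q α z + r α ≤ ∑ z, q β z + r β) :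
    UpFlow o v (fun α z => q α z + r α * (if v = z then 1 else 0)) := by
  obtain ⟨C, X, h⟩ := h
  have hmass : ∀ α, ∑ z, (q α z + r α * (if v = z then 1 else 0)) = ∑ z, q α z + r α := by
    intro α
    simp [Finset.sum_add_distrib]
  let Y : A → ℝ → S := fun α t => if t < ∑ z, q α z then X α t else v
  have hY : ∀ α z, MeasurableSet {t | Y α t = z} := by
    intro α z
    have : {t | Y α t = z} = (Iio (∑ z, q α z) ∩ {t | X α t = z}) ∪
        (Ici (∑ z, q α z) ∩ {_t | v = z}) := by
      ext t
      by_cases ht : t < ∑ z, q α z <;> simp [Y, ht, not_le.2, not_lt.1]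
    rw [this]
    exact (measurableSet_Iio.inter (h.meas α z)).union
      (measurableSet_Ici.inter (MeasurableSet.const _))
  have hle : ∀ α t, v ≤ Y α t := by
    intro α t
    simp only [Y]
    split_ifs
    · exact hv.trans (h.le α t)
    · exact le_rfl
  have hm : ∀ t, Monotone fun α => Y α t := by
    intro t α β hαβ
    by_cases h1 : t < ∑ z, q α z
    · have h2 := h1.trans_le (h.mass_mono α β hαβ)
      simpa [Y, h1, h2] using h.mono α β hαβ t h1
    · simpa [Y, h1] using hle β t
  refine ⟨_, Y, add_mem_monoCone h.closed (occ_mem_monoCone (I := Ico (∑ z, q o z)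
    (∑ z, q o z + r o)) measurableSet_Ico (by simp) hY fun t _ => hm t), hY, hle, ?_,
    fun α β hαβ t _ => hm t hαβ, ?_⟩
  · intro α β hαβ
    rw [hmass, hmass]
    exact hmono α β hαβ
  · intro α z
    rw [hmass, hmass, add_assoc, occ_Ico_add (hY α z) (by linarith [hr o]) (hmono o α (ho α)),
      ← occ_Ico_add (hY α z) (h.mass_mono o α (ho α)) (by linarith [hr α]), h.eq α z]
    have e1 : occ (Ico (∑ z, q o z) (∑ z, q α z)) (X α) z =
        occ (Ico (∑ z, q o z) (∑ z, q α z)) (Y α) z := by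
      apply occ_congr
      intro t ht
      simp [Y, ht.2]
    have e2 : occ (Ico (∑ z, q α z) (∑ z, q α z + r α)) (Y α) z =
        r α * (if v = z then 1 else 0) := by
      have := occ_const (∑ z, q α z) (∑ z, q α z + r α) v z
      rw [add_sub_cancel_left, max_eq_left (hr α)] at this
      rw [← this]
      apply occ_congr
      intro t ht
      simp [Y, not_lt.2 ht.1]
    rw [e1, e2]
    ring

/-- Several upward flows starting from a common element `v` are closed up by placing absent
particles at `v`. The remaining particles at `v` stay there until they leave upwards through another
arc at `v`. -/
lemma DownFlow.of_upFlows [Finite A] {ι : Type*} (I : Finset ι) {q : ι → A → S → ℝ} {w : ι → S}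
    (h : ∀ i ∈ I, UpFlow o (w i) (q i)) (ho : ∀ α, o ≤ α) (he : ∀ α, α ≤ e)
    (hv : ∀ i ∈ I, v ≤ w i) {r : A → ℝ} (hr : ∀ α, 0 ≤ r α)
    (hmono : ∀ α β, α ≤ β →
      ∑ i ∈ I, ∑ z, q i β z + r β ≤ ∑ i ∈ I, ∑ z, q i α z + r α) :
    DownFlow e v (fun α z => ∑ i ∈ I, q i α z + r α * (if v = z then 1 else 0)) := by
  have hmass : ∀ α, ∑ z, (∑ i ∈ I, q i α z + r α * (if v = z then 1 else 0)) =
      ∑ i ∈ I, ∑ z, q i α z + r α := by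
    intro α
    rw [Finset.sum_add_distrib, Finset.sum_comm]
    simp
  have hC := add_mem_monoCone (sum_mem_monoCone I fun i hi =>
    (h i hi).closing_mem ho he (hv i hi)) (smul_mem_monoCone
      (pointMass_mem (A := A) (f := fun _ => v) fun _ _ _ => le_rfl) (hr e))
  refine ⟨_, fun _ _ => v, monoCone_dual.1 hC, fun _ _ => MeasurableSet.const _,
    fun _ _ => le_rfl, ?_, fun _ _ _ _ _ => le_rfl, ?_⟩
  · intro α β hαβ
    have := hmono (OrderDual.ofDual β) (OrderDual.ofDual α) hαβ
    rw [← hmass, ← hmass] at this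
    exact this
  · have key : ∀ (α : A) (z : S), (∑ i ∈ I, q i α z + r α * (if v = z then 1 else 0)) =
        (∑ i ∈ I, (q i α z + (∑ z, q i e z - ∑ z, q i α z) * (if v = z then 1 else 0)) +
          r e * pointMass (fun _ : A => v) α z) +
        occ (Ico (∑ z, (∑ i ∈ I, q i e z + r e * (if v = z then 1 else 0)))
          (∑ z, (∑ i ∈ I, q i α z + r α * (if v = z then 1 else 0)))) (fun _ => v) z := by
      intro α z
      have h1 := hmono α e (he _)
      rw [hmass, hmass, occ_const, max_eq_left (by linarith), Finset.sum_add_distrib,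
        ← Finset.sum_mul, Finset.sum_sub_distrib]
      simp only [pointMass]
      ring
    exact key

end Flow

/-! ### Completion at a middle element of the diamond -/

section Region

/-- The bookkeeping for a middle element `c` of the diamond with upward branches, in terms of
masses. `Q₁` is the mass that is in `{a, c}` at the index `b`, and at the index `d` either at `c` or
in the branches; it is divided according to its positions at the indices `a, b`: `x₀` for `c, c`,
`x₁` for `a, c`, and `x₂` for `a, a`. `Q₂` is the mass that has entered the branches between the
indices `a` and `b`, divided into `y₀` starting from `c` and `y₁` starting from `a`. Masses `h₁`,
`h₂` are at `c` at the index `a` and at `d` at the index `d`, and at the index `b` they are at `d`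
or `c`. -/
lemma exists_split {Q₁ Q₂ pa pb Ba Bd : ℝ} (hQ₁ : 0 ≤ Q₁) (hQ₂ : 0 ≤ Q₂) (hpa : 0 ≤ pa)
    (hpb : 0 ≤ pb) (hBa : 0 ≤ Ba) (hBd : 0 ≤ Bd) (h₁ : Q₁ ≤ pb + Ba) (h₂ : pa ≤ Q₂ + pb + Bd) :
    ∃ x₀ x₁ x₂ y₀ y₁ h₁ h₂ : ℝ, 0 ≤ x₀ ∧ 0 ≤ x₁ ∧ 0 ≤ x₂ ∧ 0 ≤ y₀ ∧ 0 ≤ y₁ ∧ 0 ≤ h₁ ∧ 0 ≤ h₂ ∧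
      x₀ + x₁ + x₂ = Q₁ ∧ y₀ + y₁ = Q₂ ∧ x₀ + y₀ + h₁ + h₂ = pa ∧ x₀ + x₁ + h₂ ≤ pb ∧
      x₂ ≤ Ba ∧ h₁ ≤ Bd := by
  set y := min Q₂ pa with hy
  set s := min pb (pa - y) with hs
  set u := min s Q₁ with hu
  set x := min (Q₁ - u) (pb - s) with hx
  have a1 : y ≤ Q₂ := min_le_left _ _
  have a2 : y ≤ pa := min_le_right _ _
  have a3 : 0 ≤ y := le_min hQ₂ hpa
  have b1 : s ≤ pb := min_le_left _ _
  have b2 : s ≤ pa - y := min_le_right _ _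
  have b3 : 0 ≤ s := le_min hpb (by linarith)
  have c1 : u ≤ s := min_le_left _ _
  have c2 : u ≤ Q₁ := min_le_right _ _
  have c3 : 0 ≤ u := le_min b3 hQ₁
  have d1 : x ≤ Q₁ - u := min_le_left _ _
  have d2 : x ≤ pb - s := min_le_right _ _
  have d3 : 0 ≤ x := le_min (by linarith) (by linarith)
  refine ⟨u, x, Q₁ - u - x, y, Q₂ - y, pa - y - s, s - u, c3, d3, by linarith, a3, by linarith,
    by linarith, by linarith, by ring, by ring, by ring, by linarith, ?_, ?_⟩
  · rcases min_cases (Q₁ - u) (pb - s) with h | h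
    · linarith [h.1]
    · rcases min_cases s Q₁ with h' | h' <;> linarith [h.1, h'.1]
  · rcases min_cases Q₂ pa with h | h <;> rcases min_cases pb (pa - y) with h' | h' <;>
      linarith [h.1, h'.1]

variable {A S : Type*} [PartialOrder A] [PartialOrder S] {o b c e : A}

/-- The poset `A` is a diamond with the elements `o < b, c < e`. -/
structure IsDiamondIndex (o b c e : A) : Prop where
  diamond : IsDiamond o b c e
  cases : ∀ α, α = o ∨ α = b ∨ α = c ∨ α = e

lemma IsDiamond.dual {a b c d : S} (h : IsDiamond a b c d) :
    IsDiamond (S := Sᵒᵈ) (OrderDual.toDual d) (OrderDual.toDual b) (OrderDual.toDual c)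
      (OrderDual.toDual a) :=
  ⟨h.2.2.1, h.2.2.2.1, h.1, h.2.1, h.2.2.2.2.2, h.2.2.2.2.1⟩

lemma IsDiamond.swap {a b c d : S} (h : IsDiamond a b c d) : IsDiamond a c b d :=
  ⟨h.2.1, h.1, h.2.2.2.1, h.2.2.1, h.2.2.2.2.2, h.2.2.2.2.1⟩

namespace IsDiamondIndex

lemma dual (h : IsDiamondIndex o b c e) :
    IsDiamondIndex (A := Aᵒᵈ) (OrderDual.toDual e) (OrderDual.toDual b) (OrderDual.toDual c)
      (OrderDual.toDual o) := by
  refine ⟨h.diamond.dual, fun α => ?_⟩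
  rcases h.cases (OrderDual.ofDual α) with h | h | h | h
  · exact Or.inr (Or.inr (Or.inr h))
  · exact Or.inr (Or.inl h)
  · exact Or.inr (Or.inr (Or.inl h))
  · exact Or.inl h

lemma swap (h : IsDiamondIndex o b c e) : IsDiamondIndex o c b e :=
  ⟨h.diamond.swap, fun α => by rcases h.cases α with h | h | h | h <;> simp [h]⟩

lemma bot_le (h : IsDiamondIndex o b c e) (α : A) : o ≤ α := by
  obtain ⟨h1, h2, h3, h4, h5, h6⟩ := h.diamond
  rcases h.cases α with rfl | rfl | rfl | rfl
  exacts [le_rfl, h1.le, h2.le, (h1.trans h3).le]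

lemma le_top (h : IsDiamondIndex o b c e) (α : A) : α ≤ e :=
  h.dual.bot_le (OrderDual.toDual α)

end IsDiamondIndex

/-- The map on the diamond `o < b, c < e` with the values `x`, `y`, `z`, `w` at `o`, `b`, `c`, `e`.
-/
def quad (o b c : A) (x y z w : S) : A → S := fun α =>
  if α = o then x else if α = b then y else if α = c then z else w

omit [PartialOrder A] [PartialOrder S] in
lemma quad_o (o b c : A) (x y z w : S) : quad o b c x y z w o = x := by simp [quad]

section Quad

variable (h : IsDiamondIndex o b c e) (x y z w : S)
include h

omit [PartialOrder S] in
lemma quad_b : quad o b c x y z w b = y := by simp [quad, h.diamond.1.ne']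

omit [PartialOrder S] in
lemma quad_c : quad o b c x y z w c = z := by
  have : c ≠ b := fun h' => h.diamond.2.2.2.2.1 h'.ge
  simp [quad, h.diamond.2.1.ne', this]

omit [PartialOrder S] in
lemma quad_e : quad o b c x y z w e = w := by
  obtain ⟨h1, h2, h3, h4, h5, h6⟩ := h.diamond
  simp [quad, (h1.trans h3).ne', h3.ne', h4.ne']

lemma monotone_quad {x y z w : S} (hxy : x ≤ y) (hxz : x ≤ z) (hyw : y ≤ w) (hzw : z ≤ w) :
    Monotone (quad o b c x y z w) := by
  obtain ⟨h1, h2, h3, h4, h5, h6⟩ := h.diamond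
  intro α β hαβ
  rcases h.cases α with rfl | rfl | rfl | rfl <;> rcases h.cases β with rfl | rfl | rfl | rfl <;>
    simp only [quad_o, quad_b h, quad_c h, quad_e h] <;>
    first
    | exact le_rfl
    | assumption
    | exact hxy.trans hyw
    | exact absurd hαβ (by first | assumption | exact not_le_of_gt (by assumption) |
        exact not_le_of_gt (h1.trans h3))

end Quad

/-- `R` records the masses on the diamond `sa, sb, sc, sd` itself that complete the flows of the
branches at the middle element `sc` (with index `c`). It is concentrated on `{sa, sc, sd}`, has the
prescribed masses `pa` and `pd` at `sc` for the extreme indices, and for the other middle index `b`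
it stays within the masses `Ba`, `pb`, `Bd` available at `sa`, `sc`, `sd`. The masses `R o sa`, `R c
sc` and `R e sd` on the diagonal are unrestricted. -/
structure IsCompletion (o b c e : A) (sa sc sd : S) (pa pb pd Ba Bd : ℝ) (R : A → S → ℝ) :
    Prop where
  bot : R o sc = pa
  bot_zero : ∀ z, z ≠ sa → z ≠ sc → R o z = 0
  top : R e sc = pd
  top_zero : ∀ z, z ≠ sd → z ≠ sc → R e z = 0
  self_zero : ∀ z, z ≠ sc → R c z = 0
  other : R b sc ≤ pb
  other_bot : R b sa ≤ Ba
  other_top : R b sd ≤ Bd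
  other_zero : ∀ z, z ≠ sa → z ≠ sc → z ≠ sd → R b z = 0

omit [PartialOrder A] [PartialOrder S] in
lemma IsCompletion.of_dual {sa sc sd : S} {pa pb pd Ba Bd : ℝ} {R : A → S → ℝ}
    (h : IsCompletion (A := Aᵒᵈ) (S := Sᵒᵈ) (OrderDual.toDual e) (OrderDual.toDual b)
      (OrderDual.toDual c) (OrderDual.toDual o) (OrderDual.toDual sd) (OrderDual.toDual sc)
      (OrderDual.toDual sa) pd pb pa Bd Ba R) :
    IsCompletion o b c e sa sc sd pa pb pd Ba Bd R :=
  ⟨h.top, h.top_zero, h.bot, h.bot_zero, h.self_zero, h.other, h.other_top, h.other_bot,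
    fun z h1 h2 h3 => h.other_zero z h3 h2 h1⟩

/-- A decomposition of a mass `Q` into three parts is given by three probabilities, also if `Q = 0`.
-/
lemma exists_weights {x₀ x₁ x₂ Q : ℝ} (h₀ : 0 ≤ x₀) (h₁ : 0 ≤ x₁) (h₂ : 0 ≤ x₂)
    (hQ : x₀ + x₁ + x₂ = Q) :
    ∃ k : Fin 3 → ℝ, (∀ j, 0 ≤ k j) ∧ ∑ j, k j = 1 ∧ k 0 * Q = x₀ ∧ k 1 * Q = x₁ ∧
      k 2 * Q = x₂ := by
  by_cases h : Q = 0
  · refine ⟨![1, 0, 0], fun j => by fin_cases j <;> simp, by simp [Fin.sum_univ_three], ?_⟩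
    simp only [h, mul_zero]
    exact ⟨by linarith, by linarith, by linarith⟩
  · have hQ0 : 0 ≤ Q := by linarith
    refine ⟨![x₀ / Q, x₁ / Q, x₂ / Q], fun j => by fin_cases j <;> simp <;> positivity, ?_,
      by simp [h], by simp [h], by simp [h]⟩
    simp only [Fin.sum_univ_three, Matrix.cons_val]
    field_simp
    linarith

/-- Completion at a middle element `sc` of the diamond all of whose branches go up. The two
inequalities say that the mass of the branches, `sc` and `sa` is at least as large for the index `b`
as for `e`, and that the mass of the branches, `sc` and `sd` is at least as large for `b` as for
`o`. -/
lemma exists_completion_of_upFlows [Finite A] [Fintype S] (h : IsDiamondIndex o b c e)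
    {sa sc sd : S} (hac : sa < sc) (hcd : sc < sd) {ι : Type*} (I : Finset ι)
    {q : ι → A → S → ℝ} {w : ι → S} (hq : ∀ i ∈ I, UpFlow o (w i) (q i))
    (hw : ∀ i ∈ I, sc ≤ w i) {pa pb pd Ba Bd : ℝ} (hpa : 0 ≤ pa) (hpb : 0 ≤ pb) (hpd : 0 ≤ pd)
    (hBa : 0 ≤ Ba) (hBd : 0 ≤ Bd)
    (h₁ : pd + ∑ i ∈ I, ∑ z, q i e z ≤ pb + ∑ i ∈ I, ∑ z, q i b z + Ba)
    (h₂ : pa + ∑ i ∈ I, ∑ z, q i o z ≤ pb + ∑ i ∈ I, ∑ z, q i b z + Bd) :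
    ∃ R : A → S → ℝ, (fun α z => ∑ i ∈ I, q i α z + R α z) ∈ monoCone A S ∧
      IsCompletion o b c e sa sc sd pa pb pd Ba Bd R := by
  have hob : ∀ i ∈ I, ∑ z, q i o z ≤ ∑ z, q i b z := fun i hi => (hq i hi).mass_mono (h.bot_le b)
  have hbe : ∀ i ∈ I, ∑ z, q i b z ≤ ∑ z, q i e z := fun i hi => (hq i hi).mass_mono (h.le_top b)
  set Q₂ := ∑ i ∈ I, (∑ z, q i b z - ∑ z, q i o z) with hQ₂
  set G := ∑ i ∈ I, (∑ z, q i e z - ∑ z, q i b z) with hG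
  have hQ₂0 : 0 ≤ Q₂ := Finset.sum_nonneg fun i hi => sub_nonneg.2 (hob i hi)
  have hG0 : 0 ≤ G := Finset.sum_nonneg fun i hi => sub_nonneg.2 (hbe i hi)
  have hQ₂' := hQ₂
  have hG' := hG
  rw [Finset.sum_sub_distrib] at hQ₂' hG'
  obtain ⟨x₀, x₁, x₂, y₀, y₁, g₁, g₂, hx₀, hx₁, hx₂, hy₀, hy₁, hg₁, hg₂, hx, hy, e1, e2, e3, e4⟩ :=
    exists_split (Q₁ := pd + G) (Q₂ := Q₂) (pa := pa) (pb := pb) (Ba := Ba) (Bd := Bd)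
      (by linarith) hQ₂0 hpa hpb hBa hBd (by linarith) (by linarith)
  obtain ⟨k, hk, hk1, k0, k1, k2⟩ := exists_weights hx₀ hx₁ hx₂ hx
  obtain ⟨k', hk', hk1', k0', k1', k2'⟩ := exists_weights (Q := Q₂) hy₀ hy₁ le_rfl (by linarith)
  -- The three positions at the indices `o, b` of a particle that is at `sc` or above at `e`.
  let g : Fin 3 → A → S := ![quad o b c sc sc sc sc, quad o b c sa sc sc sc,
    quad o b c sa sa sc sc]
  have hg : ∀ j, Monotone (g j) := by
    intro j
    fin_cases j
    exacts [monotone_quad h le_rfl le_rfl le_rfl le_rfl,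
      monotone_quad h hac.le hac.le le_rfl le_rfl, monotone_quad h le_rfl hac.le hac.le le_rfl]
  have hgle : ∀ j α, g j α ≤ sc := by
    intro j α
    refine (hg j (h.le_top α)).trans (le_of_eq ?_)
    fin_cases j <;> exact quad_e h _ _ _ _
  -- In each branch the mass entering after the index `b` counts for `Q₁`, the rest for `Q₂`.
  have hmix := sum_mem_monoCone I fun i hi => (hq i hi).mixture_mem h.bot_le h.le_top Finset.univ
    (fun j _ => hg j) (fun j _ α => (hgle j α).trans (hw i hi)) (fun j _ => hk j)
    (fun j _ => hk' j) hk1 hk1' (hob i hi)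
  have hconst := sum_mem_monoCone (A := A) (S := S) Finset.univ fun j _ =>
    smul_mem_monoCone (pointMass_mem (hg j)) (mul_nonneg hpd (hk j))
  have hextra₁ := smul_mem_monoCone (pointMass_mem (monotone_quad h (x := sc) (y := sd) (z := sc)
    (w := sd) hcd.le le_rfl le_rfl hcd.le)) hg₁
  have hextra₂ := smul_mem_monoCone (pointMass_mem (monotone_quad h (x := sc) (y := sc) (z := sc)
    (w := sd) le_rfl le_rfl hcd.le hcd.le)) hg₂
  -- `E α j` is the mass placed at `g j α`.
  let E : A → Fin 3 → ℝ := fun α j => k' j * ∑ i ∈ I, max (∑ z, q i b z - ∑ z, q i α z) 0 +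
    k j * (pd + ∑ i ∈ I, max (∑ z, q i e z - max (∑ z, q i b z) (∑ z, q i α z)) 0)
  let R : A → S → ℝ := fun α z => ∑ j, E α j * pointMass (g j) α z +
    g₁ * pointMass (quad o b c sc sd sc sd) α z + g₂ * pointMass (quad o b c sc sc sc sd) α z
  have hEo : ∀ j, E o j = k' j * Q₂ + k j * (pd + G) := by
    intro j
    simp only [E, hQ₂, hG]
    congr 2
    · exact Finset.sum_congr rfl fun i hi => max_eq_left (sub_nonneg.2 (hob i hi))
    · congr 1
      refine Finset.sum_congr rfl fun i hi => ?_
      rw [max_eq_left (hob i hi), max_eq_left (sub_nonneg.2 (hbe i hi))]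
  have hEb : ∀ j, E b j = k j * (pd + G) := by
    intro j
    simp only [E, hG, sub_self, max_self, Finset.sum_const_zero, mul_zero, zero_add]
    congr 2
    exact Finset.sum_congr rfl fun i hi => max_eq_left (sub_nonneg.2 (hbe i hi))
  have hEe : ∀ j, E e j = k j * pd := by
    intro j
    simp only [E]
    rw [Finset.sum_eq_zero fun i hi => max_eq_right (sub_nonpos.2 (hbe i hi)),
      Finset.sum_eq_zero fun i hi => ?_, mul_zero, zero_add, add_zero]
    rw [max_eq_right (hbe i hi), sub_self, max_self]
  have hsum3 := hk1
  rw [Fin.sum_univ_three] at hsum3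
  refine ⟨R, ?_, ?_⟩
  · convert add_mem_monoCone (add_mem_monoCone (add_mem_monoCone hmix hconst) hextra₁) hextra₂
      using 1
    ext α z
    simp only [R, E]
    rw [Finset.sum_add_distrib, Finset.sum_comm (s := I)]
    have : ∀ j : Fin 3, (k' j * ∑ i ∈ I, max (∑ z, q i b z - ∑ z, q i α z) 0 +
        k j * (pd + ∑ i ∈ I, max (∑ z, q i e z - max (∑ z, q i b z) (∑ z, q i α z)) 0)) *
          pointMass (g j) α z = (∑ i ∈ I, (k' j * max (∑ z, q i b z - ∑ z, q i α z) 0 +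
        k j * max (∑ z, q i e z - max (∑ z, q i b z) (∑ z, q i α z)) 0) *
          pointMass (g j) α z) + pd * k j * pointMass (g j) α z := by
      intro j
      rw [← Finset.sum_mul, Finset.sum_add_distrib, ← Finset.mul_sum, ← Finset.mul_sum]
      ring
    rw [Finset.sum_congr rfl fun j _ => this j, Finset.sum_add_distrib]
    ring
  · have had := hac.trans hcd
    constructor
    · simp [R, hEo, Fin.sum_univ_three, g, pointMass, quad_o, hac.ne]
      linarith
    · intro z h1 h2
      simp [R, Fin.sum_univ_three, g, pointMass, quad_o, h1.symm, h2.symm]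
    · simp [R, hEe, Fin.sum_univ_three, g, pointMass, quad_e h, hcd.ne']
      linear_combination pd * hsum3
    · intro z h1 h2
      simp [R, Fin.sum_univ_three, g, pointMass, quad_e h, h1.symm, h2.symm]
    · intro z h1
      simp [R, Fin.sum_univ_three, g, pointMass, quad_c h, h1.symm]
    · simp [R, hEb, Fin.sum_univ_three, g, pointMass, quad_b h, hcd.ne', hac.ne]
      linarith
    · simp [R, hEb, Fin.sum_univ_three, g, pointMass, quad_b h, had.ne', hac.ne']
      linarith
    · simp [R, Fin.sum_univ_three, g, pointMass, quad_b h, hcd.ne, had.ne]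
      linarith
    · intro z h1 h2 h3
      simp [R, Fin.sum_univ_three, g, pointMass, quad_b h, h1.symm, h2.symm, h3.symm]

lemma exists_completion_of_downFlows [Finite A] [Fintype S] (h : IsDiamondIndex o b c e)
    {sa sc sd : S} (hac : sa < sc) (hcd : sc < sd) {ι : Type*} (I : Finset ι)
    {q : ι → A → S → ℝ} {w : ι → S} (hq : ∀ i ∈ I, DownFlow e (w i) (q i))
    (hw : ∀ i ∈ I, w i ≤ sc) {pa pb pd Ba Bd : ℝ} (hpa : 0 ≤ pa) (hpb : 0 ≤ pb) (hpd : 0 ≤ pd)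
    (hBa : 0 ≤ Ba) (hBd : 0 ≤ Bd)
    (h₁ : pd + ∑ i ∈ I, ∑ z, q i e z ≤ pb + ∑ i ∈ I, ∑ z, q i b z + Ba)
    (h₂ : pa + ∑ i ∈ I, ∑ z, q i o z ≤ pb + ∑ i ∈ I, ∑ z, q i b z + Bd) :
    ∃ R : A → S → ℝ, (fun α z => ∑ i ∈ I, q i α z + R α z) ∈ monoCone A S ∧
      IsCompletion o b c e sa sc sd pa pb pd Ba Bd R := by
  obtain ⟨R, hR, hR'⟩ := exists_completion_of_upFlows (A := Aᵒᵈ) (S := Sᵒᵈ) h.dual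
    (sa := OrderDual.toDual sd) (sc := OrderDual.toDual sc) (sd := OrderDual.toDual sa)
    hcd hac I hq hw hpd hpb hpa hBd hBa h₂ h₁
  exact ⟨R, monoCone_dual.2 hR, hR'.of_dual⟩

end Region

/-! ### Sides of the edges of a forest -/

section Side

variable {V : Type*} {G : SimpleGraph V} {u v w w' z z' : V}

/-- The vertices that can be reached from `v` without passing through `u`. For an edge `uv` of a
forest this is the vertex set of the component of `v` after removal of that edge. -/
def side (G : SimpleGraph V) (u v : V) : Set V := {z | ∃ p : G.Walk v z, u ∉ p.support}

lemma mem_side_self (h : G.Adj u v) : v ∈ side G u v := ⟨.nil, by simpa using h.ne⟩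

lemma notMem_side (G : SimpleGraph V) (u v : V) : u ∉ side G u v :=
  fun ⟨p, hp⟩ => hp p.end_mem_support

lemma reachable_of_mem_side (h : G.Adj v w) (hz : z ∈ side G v w) : G.Reachable v z := by
  obtain ⟨p, -⟩ := hz
  exact h.reachable.trans p.reachable

/-- Two paths in a forest with the same end points take the same first step. -/
lemma side_disjoint (hG : G.IsAcyclic) (h : G.Adj v w) (h' : G.Adj v w') (hz : z ∈ side G v w)
    (hz' : z ∈ side G v w') : w = w' := by
  obtain ⟨p, hp⟩ := hz
  obtain ⟨p', hp'⟩ := hz'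
  have h1 : (SimpleGraph.Walk.cons h p.bypass).IsPath :=
    (SimpleGraph.Walk.bypass_isPath p).cons fun hv => hp (p.support_bypass_subset_support hv)
  have h2 : (SimpleGraph.Walk.cons h' p'.bypass).IsPath :=
    (SimpleGraph.Walk.bypass_isPath p').cons fun hv => hp' (p'.support_bypass_subset_support hv)
  have := (hG.subsingleton_path v z).elim ⟨_, h1⟩ ⟨_, h2⟩
  have h3 := congrArg (fun q : G.Path v z => q.1.snd) this
  simpa using h3

lemma side_subset (hG : G.IsAcyclic) (huv : G.Adj u v) (hvw : G.Adj v w) (hwu : w ≠ u) :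
    side G v w ⊆ side G u v := by
  rintro z ⟨p, hp⟩
  refine ⟨.cons hvw p, ?_⟩
  rw [SimpleGraph.Walk.support_cons, List.mem_cons, not_or]
  refine ⟨huv.ne, fun hu => hwu ?_⟩
  refine side_disjoint hG hvw huv.symm (z := u) ⟨p.takeUntil u hu, fun h => hp ?_⟩
    (mem_side_self huv.symm)
  exact p.support_takeUntil_subset_support hu h

lemma exists_mem_side (hz : z ∈ side G u v) (hzv : z ≠ v) :
    ∃ w, G.Adj v w ∧ w ≠ u ∧ z ∈ side G v w := by
  obtain ⟨p, hp⟩ := hz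
  have hp' : u ∉ p.bypass.support := fun h => hp (p.support_bypass_subset_support h)
  have hpath := SimpleGraph.Walk.bypass_isPath p
  revert hp' hpath
  generalize p.bypass = r
  intro hp' hpath
  cases r with
  | nil => exact absurd rfl hzv
  | cons h r =>
    rw [SimpleGraph.Walk.cons_isPath_iff] at hpath
    rw [SimpleGraph.Walk.support_cons, List.mem_cons, not_or] at hp'
    exact ⟨_, h, fun h' => hp'.2 (h' ▸ r.start_mem_support), r, hpath.2⟩

lemma exists_mem_side_of_reachable (hz : G.Reachable v z) (hzv : z ≠ v) :
    ∃ w, G.Adj v w ∧ z ∈ side G v w := by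
  obtain ⟨p, hpath⟩ := hz.exists_isPath
  cases p with
  | nil => exact absurd rfl hzv
  | cons h r =>
    rw [SimpleGraph.Walk.cons_isPath_iff] at hpath
    exact ⟨_, h, r, hpath.2⟩

/-- The only edge of a forest that leaves `side G u v` is the edge `uv`. -/
lemma side_boundary (hG : G.IsAcyclic) (huv : G.Adj u v) (hz : z ∈ side G u v)
    (hzz' : G.Adj z z') : z' ∈ side G u v ∨ z' = u ∧ z = v := by
  by_cases h : z' = u
  · subst h
    exact Or.inr ⟨rfl, side_disjoint hG hzz'.symm huv (mem_side_self hzz'.symm) hz⟩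
  · obtain ⟨p, hp⟩ := hz
    exact Or.inl ⟨p.concat hzz', by simp [SimpleGraph.Walk.support_concat, hp, Ne.symm h]⟩

end Side

/-! ### Flows on the branches of an ordered forest -/

section Forest

/-- The restriction of a system of measures to the set `T`. -/
def restr {A S : Type*} (P : A → S → ℝ) (T : Set S) : A → S → ℝ :=
  fun α z => if z ∈ T then P α z else 0

variable {A S : Type*} [PartialOrder A] [PartialOrder S] [Fintype S] {o e : A}
  {G : SimpleGraph S} {K : Set S} {P : A → S → ℝ} {u v : S}

omit [PartialOrder A] [PartialOrder S] in
/-- The side of `v` away from `u` consists of `v` and the sides of its other neighbours. -/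
lemma restr_side_eq (hG : G.IsAcyclic) (P : A → S → ℝ) (huv : G.Adj u v) (α : A) (z : S) :
    restr P (side G u v) α z = ∑ w with G.Adj v w ∧ w ≠ u, restr P (side G v w) α z +
      P α v * (if v = z then 1 else 0) := by
  by_cases hzv : z = v
  · subst hzv
    simp [restr, mem_side_self huv, notMem_side]
  · rw [if_neg (Ne.symm hzv), mul_zero, add_zero]
    by_cases hz : z ∈ side G u v
    · obtain ⟨w, hvw, hwu, hw⟩ := exists_mem_side hz hzv
      rw [Finset.sum_eq_single_of_mem w (by simp [hvw, hwu])]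
      · simp [restr, hz, hw]
      · intro w' hw' hne
        simp only [Finset.mem_filter, Finset.mem_univ, true_and] at hw'
        exact if_neg fun h => hne (side_disjoint hG hw'.1 hvw h hw)
    · rw [restr, if_neg hz, Finset.sum_eq_zero]
      intro w hw
      simp only [Finset.mem_filter, Finset.mem_univ, true_and] at hw
      exact if_neg fun h => hz (side_subset hG huv hw.1 hw.2 h)

omit [PartialOrder A] [PartialOrder S] in
lemma restr_component_eq (hG : G.IsAcyclic) (P : A → S → ℝ) (v : S) (α : A) (z : S) :
    restr P {z | G.Reachable v z} α z = ∑ w with G.Adj v w, restr P (side G v w) α z +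
      P α v * (if v = z then 1 else 0) := by
  by_cases hzv : z = v
  · subst hzv
    simp [restr, notMem_side]
  · rw [if_neg (Ne.symm hzv), mul_zero, add_zero]
    by_cases hz : G.Reachable v z
    · obtain ⟨w, hvw, hw⟩ := exists_mem_side_of_reachable hz hzv
      rw [Finset.sum_eq_single_of_mem w (by simp [hvw])]
      · simp [restr, hz, hw]
      · intro w' hw' hne
        simp only [Finset.mem_filter, Finset.mem_univ, true_and] at hw'
        exact if_neg fun h => hne (side_disjoint hG hw' hvw h hw)
    · rw [restr, if_neg (by simpa using hz), Finset.sum_eq_zero]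
      intro w hw
      simp only [Finset.mem_filter, Finset.mem_univ, true_and] at hw
      exact if_neg fun h => hz (reachable_of_mem_side hw h)

/-- A forest `G` on an ordered vertex set, where edges join comparable elements, a vertex between a
lower and an upper neighbour has no other neighbours, and the system `P` gives increasing
(decreasing) masses to the sides of edges pointing up (down), as long as these contain no vertex of
the core `K`. -/
structure IsOrderedForest (G : SimpleGraph S) (K : Set S) (P : A → S → ℝ) : Prop where
  acyclic : G.IsAcyclic
  lt_or_gt : ∀ x y, G.Adj x y → x < y ∨ y < x
  chain : ∀ u v w x, G.Adj u v → G.Adj v w → u < v → v < w → G.Adj v x → x = u ∨ x = w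
  nonneg : ∀ α z, 0 ≤ P α z
  up_mono : ∀ u v, G.Adj u v → u < v → (∀ z ∈ side G u v, z ∉ K) → ∀ α β, α ≤ β →
    ∑ z, restr P (side G u v) α z ≤ ∑ z, restr P (side G u v) β z
  down_anti : ∀ u v, G.Adj u v → v < u → (∀ z ∈ side G u v, z ∉ K) → ∀ α β, α ≤ β →
    ∑ z, restr P (side G u v) β z ≤ ∑ z, restr P (side G u v) α z

namespace IsOrderedForest

lemma dual (h : IsOrderedForest G K P) : IsOrderedForest (A := Aᵒᵈ) (S := Sᵒᵈ) G K P where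
  acyclic := h.acyclic
  lt_or_gt x y hxy := (h.lt_or_gt x y hxy).symm
  chain u v w x huv hvw h1 h2 hvx :=
    (h.chain w v u x (SimpleGraph.Adj.symm hvw) (SimpleGraph.Adj.symm huv) h2 h1 hvx).symm
  nonneg := h.nonneg
  up_mono u v huv hlt hK α β hαβ := h.down_anti u v huv hlt hK β α hαβ
  down_anti u v huv hlt hK α β hαβ := h.up_mono u v huv hlt hK β α hαβ

lemma upFlow_step [Finite A] (h : IsOrderedForest G K P) (ho : ∀ α, o ≤ α) (he : ∀ α, α ≤ e)
    (huv : G.Adj u v) (hlt : u < v) (hK : ∀ z ∈ side G u v, z ∉ K)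
    (ih : ∀ w, G.Adj v w → w ≠ u → (v < w → UpFlow o w (restr P (side G v w))) ∧
      (w < v → DownFlow e w (restr P (side G v w)))) :
    UpFlow o v (restr P (side G u v)) := by
  have hmono := h.up_mono u v huv hlt hK
  have hsum : ∀ α, ∑ z, restr P (side G u v) α z =
      ∑ w with G.Adj v w ∧ w ≠ u, ∑ z, restr P (side G v w) α z + P α v := by
    intro α
    rw [Finset.sum_congr rfl fun z _ => restr_side_eq h.acyclic P huv α z,
      Finset.sum_add_distrib, Finset.sum_comm]
    simp
  have heq : restr P (side G u v) = fun α z =>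
      ∑ w with G.Adj v w ∧ w ≠ u, restr P (side G v w) α z +
        P α v * (if v = z then 1 else 0) := by
    ext α z
    exact restr_side_eq h.acyclic P huv α z
  simp only [hsum] at hmono
  rw [heq]
  -- Either `v` lies inside a chain and has a single further neighbour, above it, or all further
  -- neighbours are below `v`.
  by_cases hw : ∃ w, G.Adj v w ∧ v < w
  · obtain ⟨w, hvw, hvw'⟩ := hw
    have hwu : w ≠ u := fun h' => lt_asymm hlt (h' ▸ hvw')
    have hfil : (Finset.univ.filter fun w => G.Adj v w ∧ w ≠ u) = {w} := by
      ext x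
      simp only [Finset.mem_filter, Finset.mem_univ, true_and, Finset.mem_singleton]
      constructor
      · rintro ⟨h1, h2⟩
        exact (h.chain u v w x huv hvw hlt hvw' h1).resolve_left h2
      · rintro rfl
        exact ⟨hvw, hwu⟩
    simp only [hfil, Finset.sum_singleton] at hmono ⊢
    exact ((ih w hvw hwu).1 hvw').chain_step ho hvw'.le (fun α => h.nonneg α v) hmono
  · push Not at hw
    have hlt' : ∀ w ∈ Finset.univ.filter (fun w => G.Adj v w ∧ w ≠ u), w < v := by
      intro w hw'
      simp only [Finset.mem_filter, Finset.mem_univ, true_and] at hw'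
      exact (h.lt_or_gt v w hw'.1).resolve_left (hw w hw'.1)
    refine DownFlow.of_upFlows (A := Aᵒᵈ) (S := Sᵒᵈ) (o := OrderDual.toDual e)
      (e := OrderDual.toDual o) (v := OrderDual.toDual v) (w := fun w => OrderDual.toDual w)
      (Finset.univ.filter fun w => G.Adj v w ∧ w ≠ u) (q := fun w => restr P (side G v w))
      (r := fun α => P α v) ?_ he ho ?_ (fun α => h.nonneg α v) ?_
    · intro w hw'
      have := hlt' w hw'
      simp only [Finset.mem_filter, Finset.mem_univ, true_and] at hw'
      exact (ih w hw'.1 hw'.2).2 this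
    · exact fun w hw' => (hlt' w hw').le
    · exact fun α β hαβ => hmono β α hαβ

lemma flow_side [Finite A] (h : IsOrderedForest G K P) (ho : ∀ α, o ≤ α) (he : ∀ α, α ≤ e)
    (u v : S) (huv : G.Adj u v) (hK : ∀ z ∈ side G u v, z ∉ K) :
    (u < v → UpFlow o v (restr P (side G u v))) ∧
      (v < u → DownFlow e v (restr P (side G u v))) := by
  induction hn : (side G u v).ncard using Nat.strong_induction_on generalizing u v with
  | _ n ih =>
    subst hn
    have ih' : ∀ w, G.Adj v w → w ≠ u → (v < w → UpFlow o w (restr P (side G v w))) ∧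
        (w < v → DownFlow e w (restr P (side G v w))) := by
      intro w hvw hwu
      have hsub := side_subset h.acyclic huv hvw hwu
      refine ih _ (Set.ncard_lt_ncard ⟨hsub, fun h' => ?_⟩ (Set.toFinite _)) v w hvw
        (fun z hz => hK z (hsub hz)) rfl
      exact notMem_side G v w (h' (mem_side_self huv))
    refine ⟨fun hlt => h.upFlow_step ho he huv hlt hK ih', fun hlt => ?_⟩
    exact h.dual.upFlow_step (o := OrderDual.toDual e) (e := OrderDual.toDual o)
      (u := OrderDual.toDual u) (v := OrderDual.toDual v) he ho huv hlt hK
      fun w hvw hwu => ⟨(ih' w hvw hwu).2, (ih' w hvw hwu).1⟩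

end IsOrderedForest

end Forest

/-! ### The structure of a W-glued diamond -/

section Glued

variable {S : Type*} [PartialOrder S] {a b c d : S}

/-- In a finite poset it suffices to test upper sets on covering pairs. -/
lemma isUpperSet_of_covBy [Finite S] {U : Set S} (h : ∀ z z', z ⋖ z' → z ∈ U → z' ∈ U) :
    IsUpperSet U := by
  have := Fintype.ofFinite S
  let _ := Fintype.toLocallyFiniteOrder (α := S)
  intro x y hxy hx
  rw [le_iff_reflTransGen_covBy] at hxy
  induction hxy with
  | refl => exact hx
  | tail _ h' ih => exact h _ _ h' ih

lemma isLowerSet_of_covBy [Finite S] {U : Set S} (h : ∀ z z', z ⋖ z' → z' ∈ U → z ∈ U) :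
    IsLowerSet U := by
  have : IsUpperSet Uᶜ := isUpperSet_of_covBy fun z z' hz hzU hz'U => hzU (h z z' hz hz'U)
  simpa using this.compl

lemma hasseMinusDiamond_swap (a b c d : S) :
    hasseMinusDiamond a c b d = hasseMinusDiamond a b c d := by
  unfold hasseMinusDiamond
  congr 1
  ext x
  simp only [Set.mem_insert_iff, Set.mem_singleton_iff]
  tauto

lemma diamondBranch_swap (a b c d α : S) :
    diamondBranch a c b d α = diamondBranch a b c d α := by
  unfold diamondBranch
  rw [hasseMinusDiamond_swap]

lemma hasseMinusDiamond_le (a b c d : S) : hasseMinusDiamond a b c d ≤ SimpleGraph.hasse S :=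
  SimpleGraph.deleteEdges_le _

lemma covBy_or_covBy_of_adj {x y : S} (h : (hasseMinusDiamond a b c d).Adj x y) :
    x ⋖ y ∨ y ⋖ x := hasseMinusDiamond_le a b c d h

/-- A covering pair is an edge of the reduced graph or one of the four arcs, in the upward
direction. -/
lemma IsDiamond.adj_or_of_covBy (h : IsDiamond a b c d) {z z' : S} (hz : z ⋖ z') :
    (hasseMinusDiamond a b c d).Adj z z' ∨ (z = a ∧ z' = b) ∨ (z = a ∧ z' = c) ∨
      (z = b ∧ z' = d) ∨ (z = c ∧ z' = d) := by
  obtain ⟨h1, h2, h3, h4, h5, h6⟩ := h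
  by_cases hm : s(z, z') ∈ ({s(a, b), s(a, c), s(b, d), s(c, d)} : Set (Sym2 S))
  · right
    have hlt := hz.lt
    simp only [Set.mem_insert_iff, Set.mem_singleton_iff, Sym2.eq_iff] at hm
    rcases hm with (h | h) | (h | h) | (h | h) | (h | h)
    all_goals
      obtain ⟨rfl, rfl⟩ := h
      first
      | exact absurd hlt (lt_asymm ‹_›)
      | simp
  · left
    unfold hasseMinusDiamond
    rw [SimpleGraph.deleteEdges_adj]
    exact ⟨Or.inl hz, hm⟩

namespace IsWGluedDiamond

variable (hS : IsWGluedDiamond a b c d)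
include hS

lemma swap : IsWGluedDiamond a c b d where
  connected := hS.connected
  diamond := hS.diamond.swap
  unique a' b' c' d' h := by
    rw [hS.unique a' b' c' d' h]
    ext x
    simp only [Set.mem_insert_iff, Set.mem_singleton_iff]
    tauto
  noBelow := hS.noBelow
  noAbove := hS.noAbove
  noBelowAndAbove := hS.noBelowAndAbove
  separated α hα β hβ h := by
    rw [hasseMinusDiamond_swap] at h
    refine hS.separated α ?_ β ?_ h
    · simp only [Set.mem_insert_iff, Set.mem_singleton_iff] at hα ⊢; tauto
    · simp only [Set.mem_insert_iff, Set.mem_singleton_iff] at hβ ⊢; tauto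
  wClass α hα := by
    unfold diamondBranch
    rw [hasseMinusDiamond_swap]
    refine hS.wClass α ?_
    simp only [Set.mem_insert_iff, Set.mem_singleton_iff] at hα ⊢; tauto

lemma exists_reachable (z : S) :
    ∃ α ∈ ({a, b, c, d} : Set S), (hasseMinusDiamond a b c d).Reachable α z := by
  have key : ∀ x y : S, (SimpleGraph.hasse S).Walk x y →
      (∃ α ∈ ({a, b, c, d} : Set S), (hasseMinusDiamond a b c d).Reachable α y) →
      ∃ α ∈ ({a, b, c, d} : Set S), (hasseMinusDiamond a b c d).Reachable α x := by
    intro x y p hy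
    induction p with
    | nil => exact hy
    | @cons x y w h p ih =>
      obtain ⟨α, hα, hαy⟩ := ih hy
      have hcore : x ∈ ({a, b, c, d} : Set S) ∨ (hasseMinusDiamond a b c d).Adj y x := by
        rcases h with h | h
        · rcases hS.diamond.adj_or_of_covBy h with h | h | h | h | h
          · exact Or.inr h.symm
          all_goals simp [h.1]
        · rcases hS.diamond.adj_or_of_covBy h with h | h | h | h | h
          · exact Or.inr h
          all_goals simp [h.2]
      rcases hcore with h | h
      · exact ⟨x, h, .refl _⟩
      · exact ⟨α, hα, hαy.trans h.reachable⟩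
  obtain ⟨p⟩ := hS.connected.preconnected z a
  exact key z a p ⟨a, by simp, .refl _⟩

lemma eq_of_reachable {α β z : S} (hα : α ∈ ({a, b, c, d} : Set S))
    (hβ : β ∈ ({a, b, c, d} : Set S)) (h : (hasseMinusDiamond a b c d).Reachable α z)
    (h' : (hasseMinusDiamond a b c d).Reachable β z) : α = β :=
  hS.separated α hα β hβ (h.trans h'.symm)

lemma isAcyclic : (hasseMinusDiamond a b c d).IsAcyclic := by
  intro v p hp
  obtain ⟨α, hα, hαv⟩ := hS.exists_reachable v
  have hmem : ∀ x ∈ p.support, x ∈ diamondBranch a b c d α := fun x hx =>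
    hαv.trans (p.takeUntil x hx).reachable
  have hle : (hasseMinusDiamond a b c d).induce (diamondBranch a b c d α) ≤
      SimpleGraph.hasse (diamondBranch a b c d α) := by
    rintro ⟨x, hx⟩ ⟨y, hy⟩ h
    rcases covBy_or_covBy_of_adj (x := x) (y := y) h with h | h
    · exact Or.inl ⟨h.1, fun z h1 h2 => h.2 (c := z) h1 h2⟩
    · exact Or.inr ⟨h.1, fun z h1 h2 => h.2 (c := z) h1 h2⟩
  have hac := (hS.wClass α hα).acyclic.anti hle
  refine hac (p.induce _ hmem) ?_
  rw [← SimpleGraph.Walk.isCycle_map_iff_of_injective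
    (f := (SimpleGraph.Embedding.induce (G := hasseMinusDiamond a b c d) (diamondBranch a b c d α)).toHom)
    (SimpleGraph.Embedding.induce (G := hasseMinusDiamond a b c d)
      (diamondBranch a b c d α)).injective, SimpleGraph.Walk.map_induce]
  exact hp

/-- The exclusion of the Y-posets and their duals in the components: branching happens only at
elements that are minimal or maximal in their component. -/
lemma eq_or_eq_of_adj {u v w x : S} (huv : (hasseMinusDiamond a b c d).Adj u v)
    (hvw : (hasseMinusDiamond a b c d).Adj v w) (h₁ : u < v) (h₂ : v < w)
    (hvx : (hasseMinusDiamond a b c d).Adj v x) : x = u ∨ x = w := by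
  by_contra! hx
  obtain ⟨α, hα, hαv⟩ := hS.exists_reachable v
  have hW := hS.wClass α hα
  have hu : u ∈ diamondBranch a b c d α := hαv.trans huv.symm.reachable
  have hw : w ∈ diamondBranch a b c d α := hαv.trans hvw.reachable
  have hx' : x ∈ diamondBranch a b c d α := hαv.trans hvx.reachable
  have huv' : u ⋖ v := (covBy_or_covBy_of_adj huv).resolve_right fun h => lt_asymm h.lt h₁
  have hvw' : v ⋖ w := (covBy_or_covBy_of_adj hvw).resolve_right fun h => lt_asymm h.lt h₂
  rcases covBy_or_covBy_of_adj hvx with h | h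
  · exact hW.noY ⟨u, hu⟩ ⟨v, hαv⟩ ⟨w, hw⟩ ⟨x, hx'⟩ ⟨h₁, h₂, h.lt,
      fun hle => h.2 h₂ (lt_of_le_of_ne hle hx.2.symm),
      fun hle => hvw'.2 h.lt (lt_of_le_of_ne hle hx.2)⟩
  · exact hW.noDualY ⟨w, hw⟩ ⟨v, hαv⟩ ⟨u, hu⟩ ⟨x, hx'⟩ ⟨h₂, h₁, h.lt,
      fun hle => huv'.2 (lt_of_le_of_ne hle hx.1.symm) h.lt,
      fun hle => h.2 (lt_of_le_of_ne hle hx.1) h₁⟩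

variable [Finite S]

lemma isUpperSet_side {u v : S} (huv : (hasseMinusDiamond a b c d).Adj u v) (h : u < v)
    (hK : ∀ z ∈ side (hasseMinusDiamond a b c d) u v, z ∉ ({a, b, c, d} : Set S)) :
    IsUpperSet (side (hasseMinusDiamond a b c d) u v) := by
  refine isUpperSet_of_covBy fun z z' hzz' hz => ?_
  rcases hS.diamond.adj_or_of_covBy hzz' with h' | h' | h' | h' | h'
  · rcases side_boundary hS.isAcyclic huv hz h' with h' | ⟨rfl, rfl⟩
    · exact h'
    · exact absurd h (lt_asymm hzz'.lt)
  all_goals exact absurd (by simp [h'.1]) (hK z hz)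

lemma isLowerSet_side {u v : S} (huv : (hasseMinusDiamond a b c d).Adj u v) (h : v < u)
    (hK : ∀ z ∈ side (hasseMinusDiamond a b c d) u v, z ∉ ({a, b, c, d} : Set S)) :
    IsLowerSet (side (hasseMinusDiamond a b c d) u v) := by
  refine isLowerSet_of_covBy fun z z' hzz' hz => ?_
  rcases hS.diamond.adj_or_of_covBy hzz' with h' | h' | h' | h' | h'
  · rcases side_boundary hS.isAcyclic huv hz h'.symm with h' | ⟨rfl, rfl⟩
    · exact h'
    · exact absurd h (lt_asymm hzz'.lt)
  all_goals exact absurd (by simp [h'.2]) (hK z' hz)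

omit [Finite S] in
lemma notMem_of_mem_side {v w z : S} (hv : v ∈ ({a, b, c, d} : Set S))
    (hvw : (hasseMinusDiamond a b c d).Adj v w) (hz : z ∈ side (hasseMinusDiamond a b c d) v w) :
    z ∉ ({a, b, c, d} : Set S) := by
  intro hzK
  obtain rfl := hS.separated v hv z hzK (reachable_of_mem_side hvw hz)
  exact notMem_side _ v w hz

omit [Finite S] in
lemma not_lt_bot (x : S) : ¬ x < a := hS.noBelow a b c d x hS.diamond

omit [Finite S] in
lemma not_top_lt (x : S) : ¬ d < x := hS.noAbove a b c d x hS.diamond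

omit [Finite S] in
lemma ne_of_diamond : a ≠ b ∧ a ≠ c ∧ a ≠ d ∧ b ≠ c ∧ b ≠ d ∧ c ≠ d := by
  obtain ⟨h1, h2, h3, h4, h5, h6⟩ := hS.diamond
  exact ⟨h1.ne, h2.ne, (h1.trans h3).ne, fun h => h5 h.le, h3.ne, h4.ne⟩

lemma isUpperSet_top_branch : IsUpperSet (diamondBranch a b c d d) := by
  obtain ⟨h1, h2, h3, h4, h5, h6⟩ := hS.ne_of_diamond
  refine isUpperSet_of_covBy fun z z' hzz' hz => ?_
  rcases hS.diamond.adj_or_of_covBy hzz' with h' | h' | h' | h' | h'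
  · exact SimpleGraph.Reachable.trans hz h'.reachable
  all_goals
    obtain ⟨rfl, rfl⟩ := h'
    exact absurd (hS.separated _ (by simp) _ (by simp) hz) (by tauto)

lemma isLowerSet_bot_branch : IsLowerSet (diamondBranch a b c d a) := by
  obtain ⟨h1, h2, h3, h4, h5, h6⟩ := hS.ne_of_diamond
  refine isLowerSet_of_covBy fun z z' hzz' hz => ?_
  rcases hS.diamond.adj_or_of_covBy hzz' with h' | h' | h' | h' | h'
  · exact SimpleGraph.Reachable.trans hz h'.symm.reachable
  all_goals
    obtain ⟨rfl, rfl⟩ := h'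
    exact absurd (hS.separated _ (by simp) _ (by simp) hz) (by tauto)

lemma isUpperSet_union : IsUpperSet (diamondBranch a b c d c ∪ diamondBranch a b c d d) := by
  obtain ⟨h1, h2, h3, h4, h5, h6⟩ := hS.ne_of_diamond
  refine isUpperSet_of_covBy fun z z' hzz' hz => ?_
  rcases hS.diamond.adj_or_of_covBy hzz' with h' | h' | h' | h' | h'
  · exact hz.imp (fun hz => SimpleGraph.Reachable.trans hz h'.reachable)
      fun hz => SimpleGraph.Reachable.trans hz h'.reachable
  all_goals
    obtain ⟨rfl, rfl⟩ := h'
    first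
    | exact Or.inr (.refl _)
    | exact Or.inl (.refl _)
    | (rcases hz with hz | hz <;>
        exact absurd (hS.separated _ (by simp) _ (by simp) hz) (by tauto))

lemma isLowerSet_union : IsLowerSet (diamondBranch a b c d a ∪ diamondBranch a b c d c) := by
  obtain ⟨h1, h2, h3, h4, h5, h6⟩ := hS.ne_of_diamond
  refine isLowerSet_of_covBy fun z z' hzz' hz => ?_
  rcases hS.diamond.adj_or_of_covBy hzz' with h' | h' | h' | h' | h'
  · exact hz.imp (fun hz => SimpleGraph.Reachable.trans hz h'.symm.reachable)
      fun hz => SimpleGraph.Reachable.trans hz h'.symm.reachable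
  all_goals
    obtain ⟨rfl, rfl⟩ := h'
    first
    | exact Or.inl (.refl _)
    | exact Or.inr (.refl _)
    | (rcases hz with hz | hz <;>
        exact absurd (hS.separated _ (by simp) _ (by simp) hz) (by tauto))

/-- A component is entered from below only through its element of the diamond. -/
lemma le_of_mem_branch {β z z' : S} (hβ : β ∈ ({a, b, c, d} : Set S))
    (hz : z ∉ diamondBranch a b c d β) (hz' : z' ∈ diamondBranch a b c d β) (h : z ≤ z') :
    β ≤ z' := by
  have : IsUpperSet {x | β ≤ x ∨ x ∉ diamondBranch a b c d β} := by
    refine isUpperSet_of_covBy fun x x' hxx' hx => ?_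
    rcases hx with hx | hx
    · exact Or.inl (hx.trans hxx'.le)
    · by_cases hx' : x' ∈ diamondBranch a b c d β
      · left
        rcases hS.diamond.adj_or_of_covBy hxx' with h' | h' | h' | h' | h'
        · exact absurd (SimpleGraph.Reachable.trans hx' h'.symm.reachable) hx
        all_goals exact (hS.separated β hβ x' (by simp [h'.2]) hx').le
      · exact Or.inr hx'
  exact (this h (Or.inr hz)).resolve_right fun h => h hz'

/-- A component is left upwards only through its element of the diamond. -/
lemma le_of_mem_branch' {β z z' : S} (hβ : β ∈ ({a, b, c, d} : Set S))
    (hz : z ∈ diamondBranch a b c d β) (hz' : z' ∉ diamondBranch a b c d β) (h : z ≤ z') :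
    z ≤ β := by
  have : IsLowerSet {x | x ≤ β ∨ x ∉ diamondBranch a b c d β} := by
    refine isLowerSet_of_covBy fun x' x hxx' hx => ?_
    rcases hx with hx | hx
    · exact Or.inl (hxx'.le.trans hx)
    · by_cases hx' : x' ∈ diamondBranch a b c d β
      · left
        rcases hS.diamond.adj_or_of_covBy hxx' with h' | h' | h' | h' | h'
        · exact absurd (SimpleGraph.Reachable.trans hx' h'.reachable) hx
        all_goals exact (hS.separated β hβ x' (by simp [h'.1]) hx').ge
      · exact Or.inr hx'
  exact (this h (Or.inr hz')).resolve_right fun h => h hz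

/-- The branches at a middle element of the diamond all go up or all go down; this is the content of
the exclusion of the six-element posets. -/
lemma forall_lt_or_forall_gt : (∀ w, (hasseMinusDiamond a b c d).Adj c w → c < w) ∨
    ∀ w, (hasseMinusDiamond a b c d).Adj c w → w < c := by
  by_contra! hcon
  obtain ⟨⟨x, hcx, hx⟩, y, hcy, hy⟩ := hcon
  obtain ⟨h1, h2, h3, h4, h5, h6⟩ := hS.ne_of_diamond
  have hxc : x < c := ((covBy_or_covBy_of_adj hcx).resolve_left fun h => hx h.lt).lt
  have hcy' : c < y := ((covBy_or_covBy_of_adj hcy).resolve_right fun h => hy h.lt).lt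
  have hxT : x ∈ diamondBranch a b c d c := hcx.reachable
  have hyT : y ∈ diamondBranch a b c d c := hcy.reachable
  have hcK : c ∈ ({a, b, c, d} : Set S) := by simp
  have haT : a ∉ diamondBranch a b c d c := fun h =>
    h2 (hS.separated c hcK a (by simp) h).symm
  have hbT : b ∉ diamondBranch a b c d c := fun h =>
    h4 (hS.separated c hcK b (by simp) h).symm
  have hdT : d ∉ diamondBranch a b c d c := fun h =>
    h6 (hS.separated c hcK d (by simp) h)
  refine hS.noBelowAndAbove a b c d x y hS.diamond hxc hcy' ?_ ?_ ?_ ?_ ?_ ?_ ?_ ?_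
  · intro h
    rcases h.lt_or_eq with h | rfl
    · exact hS.not_lt_bot x h
    · exact haT hxT
  · intro h
    exact not_le_of_gt hxc (hS.le_of_mem_branch hcK haT hxT h)
  · intro h
    have := hS.swap.isLowerSet_union h (Or.inr (.refl _))
    rw [diamondBranch_swap a b c d, diamondBranch_swap a b c d] at this
    rcases this with h | h
    · exact h2 (hS.eq_of_reachable (by simp) (by simp) h hxT)
    · exact h4 (hS.eq_of_reachable (by simp) (by simp) h hxT)
  · intro h
    exact not_le_of_gt hxc (hS.le_of_mem_branch hcK hbT hxT h)
  · intro h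
    exact not_le_of_gt hcy' (hS.le_of_mem_branch' hcK hyT hbT h)
  · intro h
    have := hS.swap.isUpperSet_union h (Or.inl (.refl _))
    rw [diamondBranch_swap a b c d, diamondBranch_swap a b c d] at this
    rcases this with h | h
    · exact h4 (hS.eq_of_reachable (by simp) (by simp) h hyT)
    · exact h6 (hS.eq_of_reachable (by simp) (by simp) h hyT).symm
  · intro h
    exact not_le_of_gt hcy' (hS.le_of_mem_branch' hcK hyT hdT h)
  · intro h
    rcases h.lt_or_eq with h | rfl
    · exact hS.not_top_lt y h
    · exact hdT hyT

end IsWGluedDiamond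

end Glued

/-! ### Gluing the four components -/

section Assembly

variable {A S : Type*} [PartialOrder A] [PartialOrder S] [Fintype S] {a b c d : S}
  {o β γ e : A} {P : A → S → ℝ}

/-- Stochastic monotonicity of a system of measures given by their weights. -/
structure IsStochMono (P : A → S → ℝ) : Prop where
  nonneg : ∀ α z, 0 ≤ P α z
  mass_eq : ∀ α α', α ≤ α' → ∑ z, P α z = ∑ z, P α' z
  upper : ∀ α α', α ≤ α' → ∀ U, IsUpperSet U → ∑ z, restr P U α z ≤ ∑ z, restr P U α' z

omit [PartialOrder A] [PartialOrder S] in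
lemma sum_restr_add_sum_restr_compl (P : A → S → ℝ) (T : Set S) (α : A) :
    ∑ z, restr P T α z + ∑ z, restr P Tᶜ α z = ∑ z, P α z := by
  rw [← Finset.sum_add_distrib]
  refine Finset.sum_congr rfl fun z _ => ?_
  by_cases h : z ∈ T <;> simp [restr, h]

omit [PartialOrder A] [PartialOrder S] in
lemma sum_restr_union (P : A → S → ℝ) {T T' : Set S} (h : Disjoint T T') (α : A) :
    ∑ z, restr P (T ∪ T') α z = ∑ z, restr P T α z + ∑ z, restr P T' α z := by
  rw [← Finset.sum_add_distrib]
  refine Finset.sum_congr rfl fun z _ => ?_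
  by_cases h1 : z ∈ T
  · simp [restr, h1, Set.disjoint_left.1 h h1]
  · simp [restr, h1]

omit [PartialOrder A] in
lemma sum_restr_branch (hG : (hasseMinusDiamond a b c d).IsAcyclic)
    (P : A → S → ℝ) (v : S) (α : A) :
    ∑ z, restr P (diamondBranch a b c d v) α z =
      ∑ w with (hasseMinusDiamond a b c d).Adj v w,
        ∑ z, restr P (side (hasseMinusDiamond a b c d) v w) α z + P α v := by
  unfold diamondBranch
  rw [Finset.sum_congr rfl fun z _ => restr_component_eq hG P v α z, Finset.sum_add_distrib,
    Finset.sum_comm]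
  simp

lemma IsStochMono.lower (hP : IsStochMono P) {α α' : A} (h : α ≤ α') {L : Set S}
    (hL : IsLowerSet L) : ∑ z, restr P L α' z ≤ ∑ z, restr P L α z := by
  have h1 := hP.upper α α' h _ hL.compl
  have h2 := hP.mass_eq α α' h
  rw [← sum_restr_add_sum_restr_compl P L, ← sum_restr_add_sum_restr_compl P L] at h2
  linarith

namespace IsWGluedDiamond

variable (hS : IsWGluedDiamond a b c d)
include hS

lemma isOrderedForest (hP : IsStochMono P) :
    IsOrderedForest (hasseMinusDiamond a b c d) {a, b, c, d} P where
  acyclic := hS.isAcyclic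
  lt_or_gt _ _ h := (covBy_or_covBy_of_adj h).imp CovBy.lt CovBy.lt
  chain _ _ _ _ huv hvw h h' hvx := hS.eq_or_eq_of_adj huv hvw h h' hvx
  nonneg := hP.nonneg
  up_mono _ _ huv h hK _ _ hα := hP.upper _ _ hα _ (hS.isUpperSet_side huv h hK)
  down_anti _ _ huv h hK _ _ hα := hP.lower hα (hS.isLowerSet_side huv h hK)

omit [Fintype S] in
lemma disjoint_branch {v w : S} (hv : v ∈ ({a, b, c, d} : Set S))
    (hw : w ∈ ({a, b, c, d} : Set S)) (h : v ≠ w) :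
    Disjoint (diamondBranch a b c d v) (diamondBranch a b c d w) :=
  Set.disjoint_left.2 fun _ h1 h2 => h (hS.eq_of_reachable hv hw h1 h2)

/-- Completion at the middle element `c`. The available masses at `a` and `d` for the other middle
index `β` are what is left after the components of `a` and `d` have been served. -/
lemma exists_completion [Finite A] (hA : IsDiamondIndex o β γ e) (hP : IsStochMono P) :
    ∃ R : A → S → ℝ, (fun α z => ∑ w with (hasseMinusDiamond a b c d).Adj c w,
        restr P (side (hasseMinusDiamond a b c d) c w) α z + R α z) ∈ monoCone A S ∧
      IsCompletion o β γ e a c d (P o c) (P β c) (P e c)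
        (∑ z, restr P (diamondBranch a b c d a) β z - ∑ z, restr P (diamondBranch a b c d a) e z)
        (∑ z, restr P (diamondBranch a b c d d) β z - ∑ z, restr P (diamondBranch a b c d d) o z)
        R := by
  have hne := hS.ne_of_diamond
  have hF := hS.isOrderedForest hP
  have hflow := fun w (hw : (hasseMinusDiamond a b c d).Adj c w) =>
    hF.flow_side hA.bot_le hA.le_top c w hw fun z hz => hS.notMem_of_mem_side (by simp) hw hz
  have hBa := sub_nonneg.2 (hP.lower (hA.le_top β) hS.isLowerSet_bot_branch)
  have hBd := sub_nonneg.2 (hP.upper _ _ (hA.bot_le β) _ hS.isUpperSet_top_branch)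
  have h1 := hP.lower (hA.le_top β) hS.isLowerSet_union
  have h2 := hP.upper _ _ (hA.bot_le β) _ hS.isUpperSet_union
  rw [sum_restr_union P (hS.disjoint_branch (by simp) (by simp) hne.2.1),
    sum_restr_union P (hS.disjoint_branch (by simp) (by simp) hne.2.1),
    sum_restr_branch hS.isAcyclic P c, sum_restr_branch hS.isAcyclic P c] at h1
  rw [sum_restr_union P (hS.disjoint_branch (by simp) (by simp) hne.2.2.2.2.2),
    sum_restr_union P (hS.disjoint_branch (by simp) (by simp) hne.2.2.2.2.2),
    sum_restr_branch hS.isAcyclic P c, sum_restr_branch hS.isAcyclic P c] at h2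
  rcases hS.forall_lt_or_forall_gt with h | h
  · refine exists_completion_of_upFlows hA hS.diamond.2.1 hS.diamond.2.2.2.1 _ (w := id)
      (q := fun w => restr P (side (hasseMinusDiamond a b c d) c w)) ?_ ?_ (hP.nonneg _ _)
      (hP.nonneg _ _) (hP.nonneg _ _) hBa hBd (by linarith) (by linarith)
    · intro w hw
      simp only [Finset.mem_filter, Finset.mem_univ, true_and] at hw
      exact (hflow w hw).1 (h w hw)
    · intro w hw
      simp only [Finset.mem_filter, Finset.mem_univ, true_and] at hw
      exact (h w hw).le
  · refine exists_completion_of_downFlows hA hS.diamond.2.1 hS.diamond.2.2.2.1 _ (w := id)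
      (q := fun w => restr P (side (hasseMinusDiamond a b c d) c w)) ?_ ?_ (hP.nonneg _ _)
      (hP.nonneg _ _) (hP.nonneg _ _) hBa hBd (by linarith) (by linarith)
    · intro w hw
      simp only [Finset.mem_filter, Finset.mem_univ, true_and] at hw
      exact (hflow w hw).2 (h w hw)
    · intro w hw
      simp only [Finset.mem_filter, Finset.mem_univ, true_and] at hw
      exact (h w hw).le

/-- The component of the minimum `a`, whose branches all go up. The total mass used is that of the
greatest index `e`, so an index `α` uses the mass `P e (T) - P α (T) + P α a` at `a`, where `T` is
the component. -/
lemma bot_branch_mem [Finite A] (hA : IsDiamondIndex o β γ e) (hP : IsStochMono P) :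
    (fun α z => ∑ w with (hasseMinusDiamond a b c d).Adj a w,
        restr P (side (hasseMinusDiamond a b c d) a w) α z +
      (∑ z, restr P (diamondBranch a b c d a) e z - ∑ z, restr P (diamondBranch a b c d a) α z +
        P α a) * (if a = z then 1 else 0)) ∈ monoCone A S := by
  have hF := hS.isOrderedForest hP
  have hlt : ∀ w, (hasseMinusDiamond a b c d).Adj a w → a < w := fun w hw =>
    (hF.lt_or_gt a w hw).resolve_right (hS.not_lt_bot w)
  have h1 := add_mem_monoCone (sum_mem_monoCone
    (Finset.univ.filter fun w => (hasseMinusDiamond a b c d).Adj a w)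
    (q := fun w α z => restr P (side (hasseMinusDiamond a b c d) a w) α z +
      (∑ z, restr P (side (hasseMinusDiamond a b c d) a w) e z -
        ∑ z, restr P (side (hasseMinusDiamond a b c d) a w) α z) * (if a = z then 1 else 0))
    fun w hw => by
      simp only [Finset.mem_filter, Finset.mem_univ, true_and] at hw
      exact ((hF.flow_side hA.bot_le hA.le_top a w hw fun z hz =>
        hS.notMem_of_mem_side (by simp) hw hz).1 (hlt w hw)).closing_mem hA.bot_le hA.le_top
          (hlt w hw).le)
    (smul_mem_monoCone (pointMass_mem (A := A) (f := fun _ => a) fun _ _ _ => le_rfl)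
      (hP.nonneg e a))
  convert h1 using 1
  ext α z
  rw [Finset.sum_add_distrib, ← Finset.sum_mul, Finset.sum_sub_distrib,
    sum_restr_branch hS.isAcyclic P a, sum_restr_branch hS.isAcyclic P a, pointMass]
  ring

/-- The component of the maximum `d`, whose branches all go down; dual to `bot_branch_mem`. -/
lemma top_branch_mem [Finite A] (hA : IsDiamondIndex o β γ e) (hP : IsStochMono P) :
    (fun α z => ∑ w with (hasseMinusDiamond a b c d).Adj d w,
        restr P (side (hasseMinusDiamond a b c d) d w) α z +
      (∑ z, restr P (diamondBranch a b c d d) o z - ∑ z, restr P (diamondBranch a b c d d) α z +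
        P α d) * (if d = z then 1 else 0)) ∈ monoCone A S := by
  have hF := hS.isOrderedForest hP
  have hlt : ∀ w, (hasseMinusDiamond a b c d).Adj d w → w < d := fun w hw =>
    (hF.lt_or_gt d w hw).resolve_left (hS.not_top_lt w)
  have h1 := add_mem_monoCone (sum_mem_monoCone
    (Finset.univ.filter fun w => (hasseMinusDiamond a b c d).Adj d w)
    (q := fun w α z => restr P (side (hasseMinusDiamond a b c d) d w) α z +
      (∑ z, restr P (side (hasseMinusDiamond a b c d) d w) o z -
        ∑ z, restr P (side (hasseMinusDiamond a b c d) d w) α z) * (if d = z then 1 else 0))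
    fun w hw => by
      simp only [Finset.mem_filter, Finset.mem_univ, true_and] at hw
      have := UpFlow.closing_mem (A := Aᵒᵈ) (S := Sᵒᵈ) ((hF.flow_side hA.bot_le hA.le_top d w hw
        fun z hz => hS.notMem_of_mem_side (by simp) hw hz).2 (hlt w hw)) (e := OrderDual.toDual o)
          (v := OrderDual.toDual d) hA.le_top hA.bot_le (hlt w hw).le
      exact monoCone_dual.2 this)
    (smul_mem_monoCone (pointMass_mem (A := A) (f := fun _ => d) fun _ _ _ => le_rfl)
      (hP.nonneg o d))
  convert h1 using 1
  ext α z
  rw [Finset.sum_add_distrib, ← Finset.sum_mul, Finset.sum_sub_distrib,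
    sum_restr_branch hS.isAcyclic P d, sum_restr_branch hS.isAcyclic P d, pointMass]
  ring

omit [PartialOrder A] [Fintype S] in
lemma sum_restr_branches (P : A → S → ℝ) (α : A) (z : S) :
    restr P (diamondBranch a b c d a) α z + restr P (diamondBranch a b c d b) α z +
      restr P (diamondBranch a b c d c) α z + restr P (diamondBranch a b c d d) α z = P α z := by
  obtain ⟨h1, h2, h3, h4, h5, h6⟩ := hS.ne_of_diamond
  have key : ∀ x ∈ ({a, b, c, d} : Set S), ∀ y ∈ ({a, b, c, d} : Set S), x ≠ y →
      z ∈ diamondBranch a b c d x → z ∉ diamondBranch a b c d y := fun x hx y hy hxy h =>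
    Set.disjoint_left.1 (hS.disjoint_branch hx hy hxy) h
  obtain ⟨v, hv, hvz⟩ := hS.exists_reachable z
  change z ∈ diamondBranch a b c d v at hvz
  have hv' := hv
  simp only [Set.mem_insert_iff, Set.mem_singleton_iff] at hv'
  have k := fun y hy h => key v hv y hy h hvz
  rcases hv' with rfl | rfl | rfl | rfl
  · simp [restr, hvz, k b (by simp) h1, k c (by simp) h2, k d (by simp) h3]
  · simp [restr, hvz, k a (by simp) h1.symm, k c (by simp) h4, k d (by simp) h5]
  · simp [restr, hvz, k a (by simp) h2.symm, k b (by simp) h4.symm, k d (by simp) h6]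
  · simp [restr, hvz, k a (by simp) h3.symm, k b (by simp) h5.symm, k c (by simp) h6.symm]

/-- The four components together: a system in the cone that agrees with `P` off the diagonal, except
that it may have less mass than `P` on the diamond for the two middle indices. -/
lemma exists_le_mem_monoCone [Finite A] (hA : IsDiamondIndex o β γ e) (hP : IsStochMono P) :
    ∃ Q ∈ monoCone A S, (∀ z, z ≠ a → Q o z = P o z) ∧ (∀ z, z ≠ d → Q e z = P e z) ∧
      (∀ z ∉ ({a, b, c, d} : Set S), Q β z = P β z ∧ Q γ z = P γ z) ∧
      (Q β a ≤ P β a ∧ Q β c ≤ P β c ∧ Q β d ≤ P β d) ∧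
      (Q γ a ≤ P γ a ∧ Q γ b ≤ P γ b ∧ Q γ d ≤ P γ d) := by
  obtain ⟨Rc, hRc, hRc'⟩ := hS.exists_completion hA hP
  obtain ⟨Rb, hRb, hRb'⟩ := hS.swap.exists_completion hA.swap hP
  simp only [hasseMinusDiamond_swap a b c d, diamondBranch_swap a b c d] at hRb hRb'
  have hmem := add_mem_monoCone (add_mem_monoCone (add_mem_monoCone (hS.bot_branch_mem hA hP) hRb)
    hRc) (hS.top_branch_mem hA hP)
  -- The terms at `a` and `d` are what the two extreme components use in excess of `P`; the middle
  -- elements use `Rb` and `Rc` instead of `P`.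
  set Q : A → S → ℝ := fun α z => P α z +
    ((∑ z, restr P (diamondBranch a b c d a) e z - ∑ z, restr P (diamondBranch a b c d a) α z) *
      (if a = z then 1 else 0) + (Rb α z - P α b * (if b = z then 1 else 0)) +
      (Rc α z - P α c * (if c = z then 1 else 0)) +
      (∑ z, restr P (diamondBranch a b c d d) o z - ∑ z, restr P (diamondBranch a b c d d) α z) *
      (if d = z then 1 else 0)) with hQ
  have hQmem : Q ∈ monoCone A S := by
    convert hmem using 1
    ext α z
    have h := hS.sum_restr_branches P α z
    have hr := fun v => restr_component_eq hS.isAcyclic P v α z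
    change ∀ v, restr P (diamondBranch a b c d v) α z = _ at hr
    rw [hr a, hr b, hr c, hr d] at h
    simp only [hQ]
    rw [← h]
    ring
  obtain ⟨h1, h2, h3, h4, h5, h6⟩ := hS.ne_of_diamond
  refine ⟨Q, hQmem, ?_, ?_, ?_, ⟨?_, ?_, ?_⟩, ⟨?_, ?_, ?_⟩⟩
  · intro z hz
    simp only [hQ, sub_self, zero_mul, add_zero, hz.symm, if_false, mul_zero, zero_add]
    by_cases hb : b = z
    · subst hb
      simp [hRb'.bot, hRc'.bot_zero b hz h4, h4.symm]
    · by_cases hc : c = z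
      · subst hc
        simp [hRc'.bot, hRb'.bot_zero c hz h4.symm, h4]
      · simp [hRc'.bot_zero z hz (Ne.symm hc), hRb'.bot_zero z hz (Ne.symm hb), hb, hc]
  · intro z hz
    simp only [hQ, sub_self, zero_mul, add_zero, hz.symm, if_false, mul_zero, zero_add]
    by_cases hb : b = z
    · subst hb
      simp [hRb'.top, hRc'.top_zero b hz h4, h4.symm]
    · by_cases hc : c = z
      · subst hc
        simp [hRc'.top, hRb'.top_zero c hz h4.symm, h4]
      · simp [hRc'.top_zero z hz (Ne.symm hc), hRb'.top_zero z hz (Ne.symm hb), hb, hc]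
  · intro z hz
    simp only [Set.mem_insert_iff, Set.mem_singleton_iff, not_or] at hz
    obtain ⟨za, zb, zc, zd⟩ := hz
    constructor
    · simp [hQ, hRc'.other_zero z za zc zd, hRb'.self_zero z zb, Ne.symm za, Ne.symm zb,
        Ne.symm zc, Ne.symm zd]
    · simp [hQ, hRb'.other_zero z za zb zd, hRc'.self_zero z zc, Ne.symm za, Ne.symm zb,
        Ne.symm zc, Ne.symm zd]
  · simp [hQ, hRb'.self_zero a h1, h1.symm, h2.symm, h3.symm]
    linarith [hRc'.other_bot]
  · simp [hQ, hRb'.self_zero c h4.symm, h2, h4, h6.symm]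
    linarith [hRc'.other]
  · simp [hQ, hRb'.self_zero d h5.symm, h3, h5, h6]
    linarith [hRc'.other_top]
  · simp [hQ, hRc'.self_zero a h2, h1.symm, h2.symm, h3.symm]
    linarith [hRb'.other_bot]
  · simp [hQ, hRc'.self_zero b h4, h1, h4.symm, h5.symm]
    linarith [hRb'.other]
  · simp [hQ, hRc'.self_zero d h6.symm, h3, h5, h6]
    linarith [hRb'.other_top]

/-- A system in the cone that agrees with `P` off the diagonal. The missing masses for a middle
index are supplied by the maps that move only that index, to another element of the diamond, and fix
the other three. -/
lemma exists_mem_monoCone [Finite A] (hA : IsDiamondIndex o β γ e) (hP : IsStochMono P) :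
    ∃ Q ∈ monoCone A S, ∀ α z, z ≠ quad o β γ a b c d α → Q α z = P α z := by
  obtain ⟨Q, hQ, ho, he, hK, ⟨hβa, hβc, hβd⟩, hγa, hγb, hγd⟩ := hS.exists_le_mem_monoCone hA hP
  obtain ⟨hab, hac, hbd, hcd, -, -⟩ := hS.diamond
  have had := hab.trans hbd
  have hm : ∀ {y z : S}, a ≤ y → y ≤ d → a ≤ z → z ≤ d → ∀ {r : ℝ}, 0 ≤ r →
      (fun α x => r * pointMass (quad o β γ a y z d) α x) ∈ monoCone A S := fun h1 h2 h3 h4 _ hr =>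
    smul_mem_monoCone (pointMass_mem (monotone_quad hA h1 h3 h2 h4)) hr
  have hβ := add_mem_monoCone (add_mem_monoCone
    (hm le_rfl had.le hac.le hcd.le (sub_nonneg.2 hβa))
    (hm hac.le hcd.le hac.le hcd.le (sub_nonneg.2 hβc)))
    (hm had.le le_rfl hac.le hcd.le (sub_nonneg.2 hβd))
  have hγ := add_mem_monoCone (add_mem_monoCone
    (hm hab.le hbd.le le_rfl had.le (sub_nonneg.2 hγa))
    (hm hab.le hbd.le hab.le hbd.le (sub_nonneg.2 hγb)))
    (hm hab.le hbd.le had.le le_rfl (sub_nonneg.2 hγd))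
  refine ⟨_, add_mem_monoCone hQ (add_mem_monoCone hβ hγ), fun α z hz => ?_⟩
  obtain ⟨h1, h2, h3, h4, h5, h6⟩ := hS.ne_of_diamond
  rcases hA.cases α with rfl | rfl | rfl | rfl
  · rw [quad_o] at hz
    simp [pointMass, quad_o, hz.symm, ho z hz]
  · rw [quad_b hA] at hz
    simp only [pointMass, quad_b hA, hz.symm, if_false, mul_zero, add_zero]
    by_cases hzK : z ∈ ({a, b, c, d} : Set S)
    · simp only [Set.mem_insert_iff, Set.mem_singleton_iff] at hzK
      rcases hzK with rfl | rfl | rfl | rfl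
      · simp [h2.symm, h3.symm]
      · exact absurd rfl hz
      · simp [h2, h6.symm]
      · simp [h3, h6]
    · rw [(hK z hzK).1]
      simp only [Set.mem_insert_iff, Set.mem_singleton_iff, not_or] at hzK
      simp [Ne.symm hzK.1, Ne.symm hzK.2.2.1, Ne.symm hzK.2.2.2]
  · rw [quad_c hA] at hz
    simp only [pointMass, quad_c hA, hz.symm, if_false, mul_zero, add_zero]
    by_cases hzK : z ∈ ({a, b, c, d} : Set S)
    · simp only [Set.mem_insert_iff, Set.mem_singleton_iff] at hzK
      rcases hzK with rfl | rfl | rfl | rfl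
      · simp [h1.symm, h3.symm]
      · simp [h1, h5.symm]
      · exact absurd rfl hz
      · simp [h3, h5]
    · rw [(hK z hzK).2]
      simp only [Set.mem_insert_iff, Set.mem_singleton_iff, not_or] at hzK
      simp [Ne.symm hzK.1, Ne.symm hzK.2.1, Ne.symm hzK.2.2.2]
  · rw [quad_e hA] at hz
    simp [pointMass, quad_e hA, hz.symm, he z hz]

end IsWGluedDiamond

end Assembly

/-! ### Realization on an interval -/

section Realization

variable {ι S : Type*} [PartialOrder ι] [PartialOrder S] [MeasurableSpace S]
  [DiscreteMeasurableSpace S]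

omit [DiscreteMeasurableSpace S] in
/-- A finite combination of point masses of monotone maps is realized by constant maps on
consecutive intervals. -/
lemma exists_realization [Nonempty S] {F : Type*} (I : Finset F) (f : F → ι → S)
    (hf : ∀ i, Monotone (f i)) (w : F → ℝ≥0) :
    ∃ (p : ℝ) (X : ι → ℝ → S), 0 ≤ p ∧ (∀ α, Measurable (X α)) ∧
      (∀ α, (volume.restrict (Set.Ico 0 p)).map (X α) =
        ∑ i ∈ I, w i • Measure.dirac (f i α)) ∧
      ∀ t ∈ Set.Ico 0 p, Monotone fun α => X α t := by
  induction I using Finset.induction_on with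
  | empty =>
    refine ⟨0, fun _ _ => Classical.arbitrary S, le_rfl, fun _ => measurable_const, ?_, ?_⟩
    · simp
    · simp
  | insert i I hi ih =>
    obtain ⟨p, X, hp, hX, hmap, hmono⟩ := ih
    have hmeas : ∀ α, Measurable fun t => if t < p then X α t else f i α := fun α =>
      Measurable.ite measurableSet_Iio (hX α) measurable_const
    refine ⟨p + w i, fun α t => if t < p then X α t else f i α, by positivity, hmeas, ?_, ?_⟩
    · intro α
      rw [Finset.sum_insert hi, ← hmap α,
        ← Set.Ico_union_Ico_eq_Ico hp (le_add_of_nonneg_right (NNReal.coe_nonneg (w i))),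
        Measure.restrict_union _ measurableSet_Ico, Measure.map_add _ _ (hmeas α), add_comm]
      · congr 1
        · have : (fun t => if t < p then X α t else f i α) =ᵐ[volume.restrict (Ico p (p + w i))]
              fun _ => f i α := by
            filter_upwards [ae_restrict_mem measurableSet_Ico] with t ht
            simp [not_lt.2 ht.1]
          rw [Measure.map_congr this, Measure.map_const]
          rw [Measure.restrict_apply_univ, Real.volume_Ico, add_sub_cancel_left,
            ENNReal.ofReal_coe_nnreal]
          rfl
        · refine Measure.map_congr ?_
          filter_upwards [ae_restrict_mem measurableSet_Ico] with t ht
          simp [ht.2]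
      · rw [Set.disjoint_left]
        intro t ht ht'
        exact absurd ht.2 (not_lt.2 ht'.1)
    · intro t ht α β hαβ
      by_cases h : t < p
      · simpa [h] using hmono t ⟨ht.1, h⟩ hαβ
      · simpa [h] using hf i hαβ

lemma isRealizablyMonotone_of_mem_monoCone [Nonempty S] [Finite ι] [Finite S] {q : ι → S → ℝ}
    (hq : q ∈ monoCone ι S) {M : ι → Measure S} [∀ α, IsFiniteMeasure (M α)]
    (hM : ∀ α z, (M α).real {z} = q α z) : IsRealizablyMonotone M := by
  have := Fintype.ofFinite ι
  have := Fintype.ofFinite S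
  have hset : {q : ι → S → ℝ | ∃ f : ι → S, Monotone f ∧ q = pointMass f} =
      Set.range fun f : {f : ι → S // Monotone f} => pointMass f.1 := by
    ext q
    constructor
    · rintro ⟨f, hf, rfl⟩
      exact ⟨⟨f, hf⟩, rfl⟩
    · rintro ⟨f, rfl⟩
      exact ⟨f.1, f.2, rfl⟩
  rw [monoCone, hset, Submodule.mem_span_range_iff_exists_fun] at hq
  obtain ⟨w, rfl⟩ := hq
  obtain ⟨p, X, -, hX, hmap, hmono⟩ := exists_realization Finset.univ
    (fun f : {f : ι → S // Monotone f} => f.1) (fun f => f.2) w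
  refine ⟨p, X, hX, fun α => ?_, fun α β hαβ t ht => hmono t ht hαβ⟩
  rw [hmap α]
  refine Measure.ext_of_singleton fun z => ?_
  rw [← ENNReal.toReal_eq_toReal_iff' (measure_ne_top _ _) (measure_ne_top _ _)]
  change _ = (M α).real {z}
  rw [hM α z, Measure.finsetSum_apply, ENNReal.toReal_sum fun _ _ => measure_ne_top _ _]
  simp only [Finset.sum_apply, Pi.smul_apply]
  refine Finset.sum_congr rfl fun f _ => ?_
  by_cases h : f.1 α = z <;> simp [pointMass, h, NNReal.smul_def]

end Realization

/-! ### Systems of measures indexed by the diamond -/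

section System

variable {ι S : Type*} [PartialOrder ι] [PartialOrder S] [Fintype S] [MeasurableSpace S]
  [DiscreteMeasurableSpace S]

omit [PartialOrder ι] in
lemma sum_restr_measureReal (P : ι → Measure S) [∀ α, IsFiniteMeasure (P α)] (U : Set S) (α : ι) :
    ∑ z, restr (fun α z => (P α).real {z}) U α z = (P α).real U := by
  simp only [restr]
  rw [← Finset.sum_filter, sum_measureReal_singleton]
  simp

lemma IsStochasticallyMonotone.isStochMono {P : ι → Measure S} [∀ α, IsFiniteMeasure (P α)]
    (hP : IsStochasticallyMonotone P) : IsStochMono fun α z => (P α).real {z} where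
  nonneg _ _ := measureReal_nonneg
  mass_eq α α' h := by
    rw [sum_measureReal_singleton, sum_measureReal_singleton, Finset.coe_univ, measureReal_def,
      measureReal_def, (hP α α' h).1]
  upper α α' h U hU := by
    rw [sum_restr_measureReal, sum_restr_measureReal]
    exact ENNReal.toReal_mono (measure_ne_top _ _) ((hP α α' h).2 U hU)

omit [Fintype S] [MeasurableSpace S] [DiscreteMeasurableSpace S] in
lemma IsDiamond.isDiamondIndex {a b c d : S} (h : IsDiamond a b c d) :
    IsDiamondIndex (A := ({a, b, c, d} : Set S)) ⟨a, by simp⟩ ⟨b, by simp⟩ ⟨c, by simp⟩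
      ⟨d, by simp⟩ where
  diamond := h
  cases := by
    rintro ⟨x, hx⟩
    simpa using hx

end System

end

theorem theorem3p3 {S : Type*} [Finite S] [PartialOrder S]
    [MeasurableSpace S] [DiscreteMeasurableSpace S]
    (a b c d : S) (hS : IsWGluedDiamond a b c d)
    (P : ({a, b, c, d} : Set S) → Measure S) [∀ α, IsFiniteMeasure (P α)]
    (hP : IsStochasticallyMonotone P) :
    IsRealizablyWeaklyMonotone P := by
  classical
  have := Fintype.ofFinite S
  have : Nonempty S := ⟨a⟩
  have hA := hS.diamond.isDiamondIndex
  have hP' := hP.isStochMono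
  obtain ⟨Q, hQ, hQP⟩ := hS.exists_mem_monoCone hA hP'
  have hid : ∀ α : ({a, b, c, d} : Set S), quad ⟨a, by simp⟩ ⟨b, by simp⟩ ⟨c, by simp⟩ a b c d α
      = (α : S) := by
    intro α
    rcases hA.cases α with rfl | rfl | rfl | rfl
    exacts [quad_o _ _ _ _ _ _ _, quad_b hA _ _ _ _, quad_c hA _ _ _ _, quad_e hA _ _ _ _]
  simp only [hid] at hQP
  -- All the measures of `Q`, and all those of `P`, have the same mass, so the difference on the
  -- diagonal does not depend on the index.
  obtain ⟨θ, hθ⟩ : ∃ θ : ℝ, ∀ (α : ({a, b, c, d} : Set S)) (z : S),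
      Q α z = (P α).real {z} + if (α : S) = z then θ else 0 := by
    have hdiff : ∀ α : ({a, b, c, d} : Set S),
        ∑ z, Q α z = ∑ z, (P α).real {z} + (Q α α - (P α).real {(α : S)}) := by
      intro α
      rw [← sub_eq_iff_eq_add', ← Finset.sum_sub_distrib]
      exact Finset.sum_eq_single_of_mem _ (Finset.mem_univ _) fun z _ hz =>
        sub_eq_zero.2 (hQP α z hz)
    refine ⟨∑ z, Q ⟨a, by simp⟩ z - ∑ z, (P ⟨a, by simp⟩).real {z}, fun α z => ?_⟩
    split_ifs with h
    · subst h
      have h1 := mass_eq_of_mem_monoCone hQ ⟨a, by simp⟩ α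
      have h2 := hP'.mass_eq _ _ (hA.bot_le α)
      rw [h1, h2, hdiff α]
      ring
    · rw [hQP α z (Ne.symm h), add_zero]
  -- If `θ < 0`, the identity map is added to `Q` instead of to `P`.
  refine ⟨θ.toNNReal, isRealizablyMonotone_of_mem_monoCone (add_mem_monoCone hQ (smul_mem_monoCone
    (pointMass_mem (A := ({a, b, c, d} : Set S)) (f := fun α => (α : S)) fun _ _ h => h)
    (le_max_right (-θ) 0))) fun α z => ?_⟩
  rw [measureReal_add_apply, hθ]
  by_cases h : (α : S) = z
  · rcases le_total 0 θ with h' | h' <;> simp [pointMass, h, h', measureReal_def]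
  · simp [pointMass, h, measureReal_def]
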